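/- **Conventions.** Let $C$ be a small category. A quotient of an object $G$ is an object $F$ with an epimorphism $G\to F$. Isomorphism classes of quotients of $G$ are ordered by $F\le H$ if there is a morphism $H\to F$ compatible with the maps from $G$; $[F,G]$ is the set of quotients $\geq F$. An object is minimal if its only quotient is itself. A formation is a set $W$ of isomorphism classes of objects that contains all minimal objects, contains every quotient of each of its elements, and contains the join $H\vee F$ (if it exists) of any two quotients $H,F\in W$ of an object. A level is the smallest formation containing some finite set of isomorphism classes. An epimorphism is simple if it is not an isomorphism and, whenever it is a composition of two epimorphisms, one of them is an isomorphism. $C$ is a *diamond category* if (1) the quotients of each object form a finite modular lattice; (2) each object has finite automorphism group; (3) for each level $L$ and $G\in L$, finitely many elements of $L$ have a simple epimorphism to $G$; (4) there are at most countably many isomorphism classes of minimal objects. For an epimorphism $\pi:G\to F$ let $\mu(\pi)$ be the value at $(F,G)$ of the Möbius function of the poset of quotients of $G$, let $Z(\pi)$ be the number of $H\in[F,G]$ with $H\vee(K_1\wedge K_2)=(H\vee K_1)\wedge(H\vee K_2)$ for all $K_1,K_2\in[F,G]$, and put $\hat\mu(F,G)=\sum_{\pi\in \mathrm{Epi}(G,F)/\mathrm{Aut}(F)}\mu(\pi)$.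 Real numbers $(M_G)_{G\in C/\cong}$ are *well-behaved* if $\sum_{G\in L}\sum_{\pi\in \mathrm{Epi}(G,F)}\frac{|\mu(\pi)|}{|\mathrm{Aut}(G)|}Z(\pi)^3|M_G|<\infty$ for every level $L$ and every $F\in L$. A pro-isomorphism class $X$ consists of an isomorphism class $X^L\in L$ for every level $L$ such that for $L\subseteq L'$ the maximal quotient of $X^{L'}$ lying in $L$ is $X^L$. Let $\mathcal P$ be the set of pro-isomorphism classes, with the topology and the $\sigma$-algebra generated by the sets $U_{L,F}=\{X: X^L\cong F\}$, $L$ a level, $F\in L$. Let $|\mathrm{Epi}(X,G)|=|\mathrm{Epi}(X^L,G)|$ for any level $L$ containing $G$. The $G$-moment of a measure $\nu$ on $\mathcal P$ is $\int_{\mathcal P}|\mathrm{Epi}(X,G)|\,d\nu\in[0,\infty]$. For a set $S$ of isomorphism classes of minimal objects let $\mathcal P_S$ be the set of $X$ whose minimal quotient $X^{L_0}$ is in $S$, where $L_0$ is the level of all minimal objects. Measures $\nu^t$ converge weakly to $\nu$ if $\int f\,d\nu^t\to\int f\,d\nu$ for every bounded continuous $f\ge 0$. **Theorem.** Let $C$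 be a diamond category with at most countably many isomorphism classes, and let $(M_G)_{G\in C/\cong}$ be well-behaved real numbers. Let $(\nu^t)_{t\in\mathbb N}$ be a sequence of measures on $\mathcal P$ such that for all $G\in C$ $$\lim_{t\to\infty}\int_{\mathcal P}|\mathrm{Epi}(X,G)|\,d\nu^t=M_G.$$ Then there is a measure $\nu$ on $\mathcal P$ with $G$-moment $M_G$ for all $G\in C$. It is unique, and $\nu(U_{L,F})=\sum_{G\in L}\frac{\hat\mu(F,G)}{|\mathrm{Aut}(G)|}M_G<\infty$ (absolutely convergent) for every level $L$ and $F\in L$. As $t\to\infty$ the $\nu^t$ converge weakly to $\nu$ over any finite set of minimal objects: for every finite set $S$ of isomorphism classes of minimal objects, $\nu^t|_{\mathcal P_S}$ converges weakly to $\nu|_{\mathcal P_S}$. In particular, if $C$ has only finitely many isomorphism classes of minimal objects, then $\nu$ is finite and $\nu^t$ converges weakly to $\nu$. In general, if $\nu(\mathcal P)<\infty$ and $\nu^t(\mathcal P)\to\nu(\mathcal P)$, then $\nu^t$ converges weakly to $\nu$. -/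

import Mathlib

open CategoryTheory MeasureTheory Filter Topology
open scoped ENNReal NNReal

universe u v

noncomputable section

namespace DiamondMoment

section Quotients

variable {C : Type u} [Category.{v} C]

/-- The set `C/≅` of isomorphism classes of objects of `C`. -/
def IsoClass (C : Type u) [Category.{v} C] : Type u := Quotient (isIsomorphicSetoid C)

/-- The isomorphism class of an object. -/
def cls (G : C) : IsoClass C := Quotient.mk (isIsomorphicSetoid C) G

/-- A representative of an isomorphism class. -/
def IsoClass.rep (c : IsoClass C) : C := Quotient.out c

/-- The set of epimorphisms from `G` to `F`. -/
def Epis (G F : C) : Type v := {f : G ⟶ F // Epi f}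

/-- Quotients of `G` (objects with an epimorphism from `G`) up to isomorphism, as subobjects of
`G` in the opposite category.  The order is the usual one: `F ≤ H` if and only if there is a
morphism `H ⟶ F` compatible with the maps from `G`; see `quotMk_le_quotMk_iff`. -/
abbrev QuotObj (G : C) : Type (max u v) := Subobject (Opposite.op G)

/-- The class of the quotient given by an epimorphism. -/
def quotMk {G F : C} (f : Epis G F) : QuotObj G :=
  haveI : Epi f.1 := f.2
  Subobject.mk f.1.op

theorem quotMk_le_quotMk_iff {G F H : C} (f : Epis G F) (h : Epis G H) :
    quotMk f ≤ quotMk h ↔ ∃ k : H ⟶ F, h.1 ≫ k = f.1 := by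
  have : Epi f.1 := f.2
  have : Epi h.1 := h.2
  constructor
  · intro hle
    refine ⟨(Subobject.ofMkLEMk f.1.op h.1.op hle).unop, ?_⟩
    apply Quiver.Hom.op_inj
    exact Subobject.ofMkLEMk_comp (f := f.1.op) (g := h.1.op) hle
  · rintro ⟨k, hk⟩
    refine Subobject.mk_le_mk_of_comm k.op ?_
    rw [← op_comp, hk]

/-- The isomorphism class (in `C`) of the object underlying a quotient. -/
def quotCls {G : C} (x : QuotObj G) : IsoClass C := cls (Opposite.unop (x : Cᵒᵖ))

/-- An object is minimal if its only quotient is itself. -/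
def IsMinimalObj (G : C) : Prop := ∀ x : QuotObj G, x = ⊤

/-- The isomorphism classes of minimal objects. -/
def minimalClasses (C : Type u) [Category.{v} C] : Set (IsoClass C) :=
  {c | ∃ G : C, cls G = c ∧ IsMinimalObj G}

def IsDownwardClosed (W : Set (IsoClass C)) : Prop :=
  ∀ (G : C) (x : QuotObj G), cls G ∈ W → quotCls x ∈ W

def IsJoinClosed (W : Set (IsoClass C)) : Prop :=
  ∀ (G : C) (x y z : QuotObj G), IsLUB {x, y} z → quotCls x ∈ W → quotCls y ∈ W → quotCls z ∈ W

/-- A formation: downward-closed, join-closed, and containing all minimal objects. -/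
structure IsFormation (W : Set (IsoClass C)) : Prop where
  downward : IsDownwardClosed W
  join : IsJoinClosed W
  minimal : minimalClasses C ⊆ W

/-- The smallest formation containing `B`. -/
def generate (B : Set (IsoClass C)) : Set (IsoClass C) := ⋂₀ {W | IsFormation W ∧ B ⊆ W}

/-- A level: a set of isomorphism classes generated by a finite set. -/
def Level (C : Type u) [Category.{v} C] : Type u :=
  {L : Set (IsoClass C) // ∃ B : Set (IsoClass C), B.Finite ∧ L = generate B}

/-- The level generated by a finite set. -/
def levelOf (B : Finset (IsoClass C)) : Level C :=
  ⟨generate (B : Set (IsoClass C)), _, B.finite_toSet, rfl⟩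

/-- A simple epimorphism: not an isomorphism, and in every factorization into two epimorphisms
one of the factors is an isomorphism. -/
def IsSimpleEpi {G F : C} (f : G ⟶ F) : Prop :=
  Epi f ∧ ¬ IsIso f ∧
    ∀ (H : C) (g : G ⟶ H) (h : H ⟶ F), Epi g → Epi h → g ≫ h = f → IsIso g ∨ IsIso h

end Quotients

/-- Diamond categories. -/
class DiamondCategory (C : Type u) [Category.{v} C] : Prop where
  /-- every object has finitely many quotients up to isomorphism, -/
  finite_quot : ∀ G : C, Finite (QuotObj G)
  /-- and they form a modular lattice for the order of quotients; -/
  modular_lattice : ∀ G : C, ∃ L : Lattice (QuotObj G),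
    (∀ x y : QuotObj G, L.le x y ↔ x ≤ y) ∧ @IsModularLattice (QuotObj G) L
  /-- automorphism groups are finite; -/
  finite_aut : ∀ G : C, Finite (Aut G)
  /-- in a level, finitely many elements have a simple epimorphism to a given element; -/
  finite_simple : ∀ (L : Level C) (G : C), cls G ∈ L.1 →
    {c | c ∈ L.1 ∧ ∃ (H : C) (f : H ⟶ G), cls H = c ∧ IsSimpleEpi f}.Finite
  /-- there are countably many isomorphism classes of minimal objects. -/
  countable_minimal : (minimalClasses C).Countable

section Diamond

variable {C : Type u} [Category.{v} C] [DiamondCategory C]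

instance (G : C) : Finite (QuotObj G) := DiamondCategory.finite_quot G

/-- The lattice structure on the quotients of `G`, extending their order. -/
instance quotLattice (G : C) : Lattice (QuotObj G) :=
  let L := (DiamondCategory.modular_lattice G).choose
  have hL := (DiamondCategory.modular_lattice G).choose_spec.1
  { (inferInstance : PartialOrder (QuotObj G)) with
    sup := L.sup
    inf := L.inf
    le_sup_left := fun a b => (hL _ _).1 (L.le_sup_left a b)
    le_sup_right := fun a b => (hL _ _).1 (L.le_sup_right a b)
    sup_le := fun a b c h₁ h₂ => (hL _ _).1 (L.sup_le a b c ((hL _ _).2 h₁) ((hL _ _).2 h₂))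
    inf_le_left := fun a b => (hL _ _).1 (L.inf_le_left a b)
    inf_le_right := fun a b => (hL _ _).1 (L.inf_le_right a b)
    le_inf := fun a b c h₁ h₂ => (hL _ _).1 (L.le_inf a b c ((hL _ _).2 h₁) ((hL _ _).2 h₂)) }

/-- The Möbius function of the (finite) poset of quotients of `G`. -/
def moebius {G : C} (x y : QuotObj G) : ℤ := by
  classical
  exact
    letI : Fintype (QuotObj G) := Fintype.ofFinite _
    letI : LocallyFiniteOrder (QuotObj G) := Fintype.toLocallyFiniteOrder
    IncidenceAlgebra.mu ℤ x y

/-- `μ(π) = μ(F, G)` for an epimorphism `π : G ⟶ F`; here `⊤` is the quotient `G` of `G`. -/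
def mu {G F : C} (π : Epis G F) : ℤ := moebius (quotMk π) ⊤

/-- `μ̂(F, G)`, the sum of `μ(π)` over `π ∈ Epi(G, F) / Aut(F)`.  The orbits of `Aut(F)` on
`Epi(G, F)` are the quotients of `G` whose underlying object is isomorphic to `F`. -/
def muHat (F : IsoClass C) (G : C) : ℤ :=
  ∑ᶠ x : {x : QuotObj G // quotCls x = F}, moebius x.1 ⊤

/-- `Z(π)`: the number of `H ∈ [F, G]` that satisfy the distributive law
`H ∨ (K₁ ∧ K₂) = (H ∨ K₁) ∧ (H ∨ K₂)` for all `K₁, K₂ ∈ [F, G]`. -/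
def Z {G F : C} (π : Epis G F) : ℕ :=
  Nat.card {H : QuotObj G // quotMk π ≤ H ∧
    ∀ K₁ K₂ : QuotObj G, quotMk π ≤ K₁ → quotMk π ≤ K₂ → H ⊔ (K₁ ⊓ K₂) = (H ⊔ K₁) ⊓ (H ⊔ K₂)}

/-- `M` is well-behaved at `W`: for all `F ∈ W`, the sum over `G ∈ W` and `π ∈ Epi(G, F)` of
`|μ(π)| / |Aut G| * Z(π)³ * |M_G|` is finite. -/
def WellBehavedAt (W : Set (IsoClass C)) (M : IsoClass C → ℝ) : Prop :=
  ∀ F : C, cls F ∈ W →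
    Summable fun p : (Σ G : W, Epis G.1.rep F) =>
      |(mu p.2 : ℝ)| / (Nat.card (Aut p.1.1.rep) : ℝ) * (Z p.2 : ℝ) ^ 3 * |M p.1.1|

/-- `M` is well-behaved at every level. -/
def WellBehaved (M : IsoClass C → ℝ) : Prop := ∀ L : Level C, WellBehavedAt L.1 M

end Diamond

section ProIsomorphismClasses

variable {C : Type u} [Category.{v} C]

/-- `d` is the isomorphism class of the maximal quotient lying in `W` of an object of class `c`. -/
def IsMaximalQuotient (W : Set (IsoClass C)) (c d : IsoClass C) : Prop :=
  ∃ (G : C) (x : QuotObj G), cls G = c ∧ IsGreatest {y : QuotObj G | quotCls y ∈ W} x ∧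
    quotCls x = d

/-- A pro-isomorphism class `X`: an element `X^L ∈ L` for each level `L`, such that the
`L`-quotient of `X^{L'}` is `X^L` whenever `L ⊆ L'`. -/
@[ext]
structure ProIso (C : Type u) [Category.{v} C] where
  val : Level C → IsoClass C
  mem : ∀ L : Level C, val L ∈ L.1
  compat : ∀ L L' : Level C, L.1 ⊆ L'.1 → IsMaximalQuotient L.1 (val L') (val L)

/-- `U_{L, F}`, the set of `X` with `X^L ≅ F`. -/
def basicOpen (L : Level C) (F : IsoClass C) : Set (ProIso C) := {X | X.val L = F}

/-- The sets `U_{L, F}` for levels `L` and `F ∈ L`. -/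
def basicOpens (C : Type u) [Category.{v} C] : Set (Set (ProIso C)) :=
  {U | ∃ (L : Level C) (F : IsoClass C), F ∈ L.1 ∧ U = basicOpen L F}

instance : TopologicalSpace (ProIso C) := TopologicalSpace.generateFrom (basicOpens C)

instance : MeasurableSpace (ProIso C) := MeasurableSpace.generateFrom (basicOpens C)

/-- `|Epi(X, G)| = |Epi(X^L, G)|` for a level `L` containing `G`.  The number does not depend on
`L`; the smallest such level is taken. -/
def epiCount (X : ProIso C) (G : C) : ℕ := Nat.card (Epis (X.val (levelOf {cls G})).rep G)

/-- The `G`-moment of a measure on pro-isomorphism classes. -/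
def moment (ν : Measure (ProIso C)) (G : C) : ℝ≥0∞ := ∫⁻ X, (epiCount X G : ℝ≥0∞) ∂ν

/-- `ν` has `G`-moment `M_G` for every `G`. -/
def HasMoments (ν : Measure (ProIso C)) (M : IsoClass C → ℝ) : Prop :=
  ∀ G : C, (moment ν G : EReal) = (M (cls G) : EReal)

/-- The pro-isomorphism classes whose minimal quotient lies in `S`.  (The level generated by the
empty set consists of the minimal objects.) -/
def overMinimal (S : Set (IsoClass C)) : Set (ProIso C) := {X | X.val (levelOf ∅) ∈ S}

end ProIsomorphismClasses

/-- Weak convergence of a sequence of measures: convergence of the integrals of all bounded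
continuous nonnegative functions (in particular of the total masses). -/
def WeaklyConverges {X : Type*} [TopologicalSpace X] [MeasurableSpace X]
    (ν : ℕ → Measure X) (ν' : Measure X) : Prop :=
  ∀ f : BoundedContinuousFunction X ℝ≥0,
    Tendsto (fun t => ∫⁻ x, (f x : ℝ≥0∞) ∂(ν t)) atTop (𝓝 (∫⁻ x, (f x : ℝ≥0∞) ∂ν'))

end DiamondMoment

end

open DiamondMoment

/-! Fix a level `L` and divide the moments by `|Aut G|`. The numbers p(H) = ν(U_{L,H}) then satisfy
∑_H p(H)·#{quotients of H of class G} = m(G) for G in `L`. Möbius inversion in the lattice of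
quotients of each H recovers p from m; well-behavedness (through Z ≥ 1) gives the absolute
convergence needed to interchange the sums. This yields uniqueness and the formula
(`HasNormalizedMoments.hasSum`).

For existence and convergence the danger is that mass in the moment sums escapes to infinity. This
is excluded by `exists_finset_loewyCount_le`, an induction on the number of complemented intervals
needed to climb from a quotient to the top. That Loewy length is bounded on a level, since
modularity makes the objects of bounded Loewy length a formation. Let [a, s] be the first layer
above a quotient a of class G, and T a large finite set of classes containing G. Either s has class
in T, and induction applies to s; or some cover in [a, s] leaves T at a quotient c, whose class lies
in a finite set D by the axiom on simple epimorphisms. Then [a, c] is still complemented, so μ(a, c)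
≠ 0 (`IsMoebius.sign_of_isComplInterval`), and the contribution of such pairs (a, c) is at most ∑_D
|μ|·m in the limit, part of the tail of a convergent series.

Hence every ultrafilter limit of the weights, which exists by compactness of [0, ∞], has moments m.
By uniqueness all these limits agree, so the weights converge. Uniqueness also makes the limits at
different levels consistent, and a Kolmogorov extension (`IsConsistent.exists_measure`) glues them
into ν. Finally, convergence on basic open sets gives lower semicontinuity on open sets; together
with convergence of the total mass to a finite value it gives weak convergence. -/

noncomputable section

namespace DiamondMoment

/-! ### Complemented intervals, Loewy chains and maximal chains in modular lattices -/

section ModularLattice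

variable {α : Type*} [Lattice α]

/-- The interval `[a, s]` is complemented. -/
def IsComplInterval (a s : α) : Prop :=
  a ≤ s ∧ ∀ x, a ≤ x → x ≤ s → ∃ y, a ≤ y ∧ y ≤ s ∧ x ⊓ y = a ∧ x ⊔ y = s

theorem IsComplInterval.refl (a : α) : IsComplInterval a a :=
  ⟨le_rfl, fun x h₁ h₂ => ⟨a, le_rfl, le_rfl, by simp [le_antisymm h₁ h₂],
    by simp [le_antisymm h₁ h₂]⟩⟩

theorem IsComplInterval.of_covBy {a s : α} (h : a ⋖ s) : IsComplInterval a s := by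
  refine ⟨h.le, fun x h₁ h₂ => ?_⟩
  rcases h.eq_or_eq h₁ h₂ with rfl | rfl
  · exact ⟨s, h.le, le_rfl, inf_eq_left.2 h.le, sup_eq_right.2 h.le⟩
  · exact ⟨a, le_rfl, h.le, inf_eq_right.2 h.le, sup_eq_left.2 h.le⟩

/-- There is a chain of length `k` of complemented intervals from `a` to `b`. -/
def HasLoewyChain : ℕ → α → α → Prop
  | 0, a, b => a = b
  | k + 1, a, b => ∃ s, IsComplInterval a s ∧ HasLoewyChain k s b

theorem HasLoewyChain.le {k : ℕ} : ∀ {a b : α}, HasLoewyChain k a b → a ≤ b := by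
  induction k with
  | zero => intro a b h; exact le_of_eq h
  | succ k ih =>
    rintro a b ⟨s, hs, h⟩
    exact hs.1.trans (ih h)

theorem HasLoewyChain.mono {k l : ℕ} (hkl : k ≤ l) {a b : α} (h : HasLoewyChain k a b) :
    HasLoewyChain l a b := by
  induction l, hkl using Nat.le_induction with
  | base => exact h
  | succ l _ ih => exact ⟨a, .refl a, ih⟩

theorem HasLoewyChain.refl (k : ℕ) (a : α) : HasLoewyChain k a a :=
  HasLoewyChain.mono (Nat.zero_le k) (show HasLoewyChain 0 a a from rfl)

theorem exists_hasLoewyChain [Finite α] {b : α} (a : α) (hab : a ≤ b) :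
    ∃ k, HasLoewyChain k a b := by
  induction a using WellFoundedGT.induction with
  | ind a ih =>
    rcases hab.eq_or_lt with rfl | hlt
    · exact ⟨0, rfl⟩
    · obtain ⟨c, hc, hcb⟩ := exists_covBy_le_of_lt hlt
      obtain ⟨k, hk⟩ := ih c hc.lt hcb
      exact ⟨k + 1, c, .of_covBy hc, hk⟩

theorem exists_forall_hasLoewyChain [Finite α] (b : α) :
    ∃ k, ∀ a, a ≤ b → HasLoewyChain k a b := by
  choose! k hk using fun a : α => exists_hasLoewyChain (b := b) a
  obtain ⟨K, hK⟩ := (Set.finite_range k).bddAbove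
  exact ⟨K, fun a ha => (hk a ha).mono (hK ⟨a, rfl⟩)⟩

/-- There is a maximal chain of length `n` from `a` to `b`. -/
def HasCoverChain : ℕ → α → α → Prop
  | 0, a, b => a = b
  | n + 1, a, b => ∃ c, HasCoverChain n a c ∧ c ⋖ b

theorem HasCoverChain.le {n : ℕ} {a : α} : ∀ {b : α}, HasCoverChain n a b → a ≤ b := by
  induction n with
  | zero => intro b h; exact le_of_eq h
  | succ n ih =>
    rintro b ⟨c, hc, h⟩
    exact (ih hc).trans h.le

theorem exists_hasCoverChain [Finite α] {a : α} (b : α) (hab : a ≤ b) :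
    ∃ n, HasCoverChain n a b := by
  induction b using WellFoundedLT.induction with
  | ind b ih =>
    rcases hab.eq_or_lt with rfl | hlt
    · exact ⟨0, rfl⟩
    · obtain ⟨c, hc, hcb⟩ := exists_le_covBy_of_lt hlt
      obtain ⟨k, hk⟩ := ih c hcb.lt hc
      exact ⟨k + 1, c, hk, hcb⟩

variable [IsModularLattice α]

theorem IsComplInterval.mono_right {a s t : α} (h : IsComplInterval a s) (hat : a ≤ t)
    (hts : t ≤ s) : IsComplInterval a t := by
  refine ⟨hat, fun x h₁ h₂ => ?_⟩
  obtain ⟨y, hy₁, -, hy₃, hy₄⟩ := h.2 x h₁ (h₂.trans hts)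
  refine ⟨y ⊓ t, le_inf hy₁ hat, inf_le_right, ?_, ?_⟩
  · rw [← inf_assoc, hy₃, inf_eq_left.2 hat]
  · rw [← sup_inf_assoc_of_le y h₂, hy₄, inf_eq_right.2 hts]

/-- The analogue of "a sum of semisimple modules is semisimple". Choose a complement `y` of `x ⊓ s`
in `[a, s]`, so that `x ⊔ y = x ⊔ s`, then a complement `z` of `(x ⊔ s) ⊓ t` in `[a, t]`; the
modular law shows that `y ⊔ z` is a complement of `x`. -/
theorem IsComplInterval.join {a s t : α} (h : IsComplInterval a s) (h' : IsComplInterval a t) :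
    IsComplInterval a (s ⊔ t) := by
  refine ⟨h.1.trans le_sup_left, fun x h₁ h₂ => ?_⟩
  obtain ⟨y, hy₁, hy₂, hy₃, hy₄⟩ := h.2 (x ⊓ s) (le_inf h₁ h.1) inf_le_right
  obtain ⟨z, hz₁, hz₂, hz₃, hz₄⟩ :=
    h'.2 ((x ⊔ s) ⊓ t) (le_inf (h₁.trans le_sup_left) h'.1) inf_le_right
  have hxy : x ⊔ y = x ⊔ s := by
    rw [← hy₄, ← sup_assoc, sup_eq_left.2 (inf_le_left : x ⊓ s ≤ x)]
  have hxy' : x ⊓ y = a := by rw [← hy₃, inf_assoc, inf_eq_right.2 hy₂]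
  have hxz : (x ⊔ y) ⊓ z = a := by rw [hxy, ← hz₃, inf_assoc, inf_eq_right.2 hz₂]
  refine ⟨y ⊔ z, hy₁.trans le_sup_left, sup_le_sup hy₂ hz₂, le_antisymm ?_ ?_, ?_⟩
  · have h₃ : (y ⊔ z) ⊓ (x ⊔ y) = y := by
      rw [sup_inf_assoc_of_le z le_sup_right, inf_comm z, hxz, sup_eq_left.2 hy₁]
    have h₄ : x ⊓ (y ⊔ z) ≤ y :=
      (le_inf inf_le_right (inf_le_left.trans le_sup_left)).trans h₃.le
    exact hxy' ▸ le_inf inf_le_left h₄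
  · exact le_inf h₁ (hy₁.trans le_sup_left)
  · rw [← sup_assoc, hxy]
    refine le_antisymm (sup_le (sup_le h₂ le_sup_left) (hz₂.trans le_sup_right)) ?_
    refine sup_le (le_sup_right.trans le_sup_left) ?_
    rw [← hz₄]
    exact sup_le (inf_le_left.trans le_sup_left) le_sup_right

theorem IsComplInterval.sup_const {a s : α} (h : IsComplInterval a s) (c : α) :
    IsComplInterval (a ⊔ c) (s ⊔ c) := by
  refine ⟨sup_le_sup_right h.1 c, fun x h₁ h₂ => ?_⟩
  have hc : c ≤ x := le_sup_right.trans h₁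
  obtain ⟨y, hy₁, hy₂, hy₃, hy₄⟩ :=
    h.2 (x ⊓ s) (le_inf (le_sup_left.trans h₁) h.1) inf_le_right
  refine ⟨y ⊔ c, sup_le_sup_right hy₁ c, sup_le_sup_right hy₂ c, ?_, ?_⟩
  · rw [sup_comm y, inf_comm, sup_inf_assoc_of_le y hc, sup_comm a, inf_comm y, ← hy₃, inf_assoc,
      inf_eq_right.2 hy₂]
  · refine le_antisymm (sup_le h₂ (sup_le_sup_right hy₂ c)) (sup_le ?_ ?_)
    · rw [← hy₄]
      exact sup_le (inf_le_left.trans le_sup_left) (le_sup_left.trans le_sup_right)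
    · exact le_sup_right.trans le_sup_right

/-- By modularity `[a ⊓ c, s ⊓ c]` is isomorphic to `[a, a ⊔ s ⊓ c]`, an initial part of `[a, s]`;
complements are taken there and intersected back. -/
theorem IsComplInterval.inf_const {a s : α} (h : IsComplInterval a s) (c : α) :
    IsComplInterval (a ⊓ c) (s ⊓ c) := by
  refine ⟨inf_le_inf_right c h.1, fun z h₁ h₂ => ?_⟩
  obtain ⟨y, hy₁, -, hy₃, hy₄⟩ := (h.mono_right (le_sup_left : a ≤ a ⊔ s ⊓ c)
    (sup_le h.1 inf_le_left)).2 (a ⊔ z) le_sup_left (sup_le_sup_left h₂ a)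
  refine ⟨y ⊓ (s ⊓ c), le_inf (inf_le_left.trans hy₁) (inf_le_inf_right c h.1), inf_le_right,
    ?_, ?_⟩
  · refine le_antisymm (le_inf ?_ ?_) (le_inf h₁ (le_inf (inf_le_left.trans hy₁)
      (inf_le_inf_right c h.1)))
    · rw [← hy₃]
      exact inf_le_inf le_sup_right inf_le_left
    · exact inf_le_right.trans (inf_le_right.trans inf_le_right)
  · rw [← sup_inf_assoc_of_le y h₂]
    refine inf_eq_right.2 (le_trans le_sup_right (hy₄.symm.le.trans ?_))
    exact sup_le (sup_le (hy₁.trans le_sup_right) le_sup_left) le_sup_right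

theorem IsComplInterval.sup {a b s t : α} (h : IsComplInterval a s) (h' : IsComplInterval b t) :
    IsComplInterval (a ⊔ b) (s ⊔ t) := by
  have h₁ := h.sup_const b
  have h₂ := h'.sup_const a
  rw [sup_comm b a] at h₂
  convert h₁.join h₂ using 1
  refine le_antisymm (sup_le_sup le_sup_left le_sup_left) (sup_le (sup_le_sup_left h'.1 s) ?_)
  rw [sup_comm]
  exact sup_le_sup_right h.1 t

theorem HasLoewyChain.sup {k : ℕ} : ∀ {a b x y : α}, HasLoewyChain k a x → HasLoewyChain k b y →
    HasLoewyChain k (a ⊔ b) (x ⊔ y) := by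
  induction k with
  | zero => rintro a b x y rfl rfl; rfl
  | succ k ih =>
    rintro a b x y ⟨s, hs, h⟩ ⟨t, ht, h'⟩
    exact ⟨s ⊔ t, hs.sup ht, ih h h'⟩

theorem HasLoewyChain.inf_const {k : ℕ} : ∀ {a b : α}, HasLoewyChain k a b → ∀ c,
    HasLoewyChain k (a ⊓ c) (b ⊓ c) := by
  induction k with
  | zero => rintro a b rfl c; rfl
  | succ k ih =>
    rintro a b ⟨s, hs, h⟩ c
    exact ⟨s ⊓ c, hs.inf_const c, ih h c⟩

/-- Jordan–Hölder: if `x` and `c` are distinct elements covered by `b`, both cover `x ⊓ c`, and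
induction along the chain through `c` supplies a chain to `x ⊓ c`. -/
theorem HasCoverChain.of_covBy {n : ℕ} {a : α} : ∀ {b x : α}, HasCoverChain (n + 1) a b → a ≤ x →
    x ⋖ b → HasCoverChain n a x := by
  induction n with
  | zero =>
    rintro b x ⟨c, rfl, hc⟩ hax hxb
    rcases hc.eq_or_eq hax hxb.le with h | h
    · exact h.symm
    · exact absurd h hxb.lt.ne
  | succ n ih =>
    rintro b x ⟨c, hc, hcb⟩ hax hxb
    by_cases hxc : x = c
    · exact hxc ▸ hc
    have hsup : x ⊔ c = b := by
      rcases hxb.eq_or_eq le_sup_left (sup_le hxb.le hcb.le) with h | h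
      · have h₁ : c ≤ x := sup_eq_left.1 h
        rcases hcb.eq_or_eq h₁ hxb.le with h₂ | h₂
        · exact absurd h₂ hxc
        · exact absurd h₂ hxb.lt.ne
      · exact h
    have h₁ : x ⊓ c ⋖ c := inf_covBy_of_covBy_sup_left (hsup.symm ▸ hxb)
    have h₂ : x ⊓ c ⋖ x := inf_covBy_of_covBy_sup_right (hsup.symm ▸ hcb)
    exact ⟨x ⊓ c, ih hc (le_inf hax hc.le) h₁, h₂⟩

end ModularLattice

/-! ### Möbius functions of finite lattices and their sign on complemented modular intervals -/

section Moebius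

open Classical in
/-- `f` is the function `μ(a, ·)` above `a`. -/
structure IsMoebius {α : Type*} [PartialOrder α] [Fintype α] (a : α) (f : α → ℤ) : Prop where
  self : f a = 1
  sum : ∀ b, a < b → ∑ x with a ≤ x ∧ x ≤ b, f x = 0

open Classical in
theorem IsMoebius.eq_neg_sum {α : Type*} [PartialOrder α] [Fintype α] {a : α} {f : α → ℤ}
    (hf : IsMoebius a f) {b : α} (hab : a < b) : f b = - ∑ x with a ≤ x ∧ x < b, f x := by
  have h := hf.sum b hab
  have h₁ : (Finset.univ.filter fun x => a ≤ x ∧ x ≤ b)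
      = insert b (Finset.univ.filter fun x => a ≤ x ∧ x < b) := by
    ext x
    simp only [Finset.mem_filter, Finset.mem_univ, true_and, Finset.mem_insert]
    constructor
    · rintro ⟨h₁, h₂⟩
      rcases h₂.eq_or_lt with h | h
      · exact .inl h
      · exact .inr ⟨h₁, h⟩
    · rintro (rfl | ⟨h₁, h₂⟩)
      · exact ⟨hab.le, le_rfl⟩
      · exact ⟨h₁, h₂.le⟩
  rw [h₁, Finset.sum_insert (by simp)] at h
  linarith

/-- The Möbius function is invariant under isomorphisms onto initial segments. -/
theorem IsMoebius.comp_orderIso {α β : Type*} [PartialOrder α] [Fintype α] [PartialOrder β]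
    [Fintype β] {t : β} (e : α ≃o Set.Iic t) {a : α} {f : α → ℤ} {g : β → ℤ}
    (hf : IsMoebius a f) (hg : IsMoebius (e a).1 g) {b : α} (hab : a ≤ b) :
    g (e b).1 = f b := by
  classical
  induction b using WellFoundedLT.induction with
  | ind b ih =>
    rcases hab.eq_or_lt with rfl | hlt
    · rw [hf.self, hg.self]
    have hlt' : (e a).1 < (e b).1 := e.strictMono hlt
    rw [hf.eq_neg_sum hlt, hg.eq_neg_sum hlt', neg_inj]
    symm
    refine Finset.sum_bij (fun x _ => (e x).1) ?_ ?_ ?_ ?_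
    · intro x hx
      simp only [Finset.mem_filter, Finset.mem_univ, true_and] at hx ⊢
      exact ⟨e.monotone hx.1, e.strictMono hx.2⟩
    · intro x _ y _ h
      exact e.injective (Subtype.ext h)
    · intro y hy
      simp only [Finset.mem_filter, Finset.mem_univ, true_and] at hy
      refine ⟨e.symm ⟨y, hy.2.le.trans (e b).2⟩, ?_, by simp⟩
      simp only [Finset.mem_filter, Finset.mem_univ, true_and]
      constructor
      · rw [OrderIso.le_symm_apply]
        exact hy.1
      · rw [OrderIso.symm_apply_lt]
        exact hy.2
    · intro x hx
      simp only [Finset.mem_filter, Finset.mem_univ, true_and] at hx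
      exact (ih x hx.2 hx.1).symm

open Classical in
/-- Weisner's theorem. -/
theorem IsMoebius.weisner {α : Type*} [Lattice α] [Fintype α] {a : α} {f : α → ℤ}
    (hf : IsMoebius a f) {b : α} (hab : a < b) (s : α) (hbs : b ≤ s) :
    ∑ x with a ≤ x ∧ x ⊔ b = s, f x = 0 := by
  induction s using WellFoundedLT.induction with
  | ind s ih =>
    have h₁ := hf.sum s (hab.trans_le hbs)
    -- Split the vanishing sum over `[a, s]` according to `x ⊔ b`. The fibres over `c < s` vanish by
    -- induction, leaving the fibre over `s`.
    rw [← Finset.sum_fiberwise_of_maps_to (t := Finset.univ.filter fun c => b ≤ c ∧ c ≤ s)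
      (g := fun x => x ⊔ b)] at h₁
    · rw [Finset.sum_eq_single_of_mem s (by simp [hbs])] at h₁
      · rw [← h₁]
        refine Finset.sum_congr ?_ fun _ _ => rfl
        ext x
        simp only [Finset.mem_filter, Finset.mem_univ, true_and]
        constructor
        · rintro ⟨h, rfl⟩
          exact ⟨⟨h, le_sup_left⟩, rfl⟩
        · rintro ⟨⟨h, -⟩, h'⟩
          exact ⟨h, h'⟩
      · intro c hc hcs
        simp only [Finset.mem_filter, Finset.mem_univ, true_and] at hc
        rw [← ih c (lt_of_le_of_ne hc.2 hcs) hc.1]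
        refine Finset.sum_congr ?_ fun _ _ => rfl
        ext x
        simp only [Finset.mem_filter, Finset.mem_univ, true_and]
        constructor
        · rintro ⟨⟨h, -⟩, h'⟩
          exact ⟨h, h'⟩
        · rintro ⟨h, rfl⟩
          exact ⟨⟨h, le_sup_left.trans hc.2⟩, rfl⟩
    · intro x hx
      simp only [Finset.mem_filter, Finset.mem_univ, true_and] at hx ⊢
      exact ⟨le_sup_right, sup_le hx.2 hbs⟩

/-- Apply Weisner's theorem to an atom `b` of `[a, s]`: `f s` is minus the sum of `f x` over the `x
≠ s` with `x ⊔ b = s`. By modularity each such `x` is covered by `s`, so by induction all terms have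
the same strict sign. Complementation enters only to provide at least one such `x`. -/
theorem IsMoebius.sign_of_isComplInterval {α : Type*} [Lattice α] [IsModularLattice α] [Fintype α]
    {a : α} {f : α → ℤ} (hf : IsMoebius a f) {n : ℕ} : ∀ {s : α}, HasCoverChain n a s →
    IsComplInterval a s → 0 < (-1) ^ n * f s := by
  classical
  induction n with
  | zero =>
    rintro s rfl -
    simp [hf.self]
  | succ n ih =>
    intro s hn hs
    have has : a < s := by
      obtain ⟨c, hc, hcs⟩ := hn
      exact hc.le.trans_lt hcs.lt
    obtain ⟨b, hab, hbs⟩ := exists_covBy_le_of_lt has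
    have hcov : ∀ x, a ≤ x → x ⊔ b = s → x ≠ s → x ⋖ s := by
      intro x hax hxb hxs
      rw [← hxb]
      refine covBy_sup_of_inf_covBy_right ?_
      rcases hab.eq_or_eq (le_inf hax hab.le) inf_le_right with h | h
      · rwa [h]
      · exact absurd (hxb ▸ (sup_eq_left.2 (inf_eq_right.1 h)).symm) hxs
    have hW := hf.weisner hab.lt s hbs
    have hins : (Finset.univ.filter fun x => a ≤ x ∧ x ⊔ b = s)
        = insert s (Finset.univ.filter fun x => a ≤ x ∧ x ⊔ b = s ∧ x ≠ s) := by
      ext x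
      simp only [Finset.mem_filter, Finset.mem_univ, true_and, Finset.mem_insert]
      constructor
      · rintro ⟨h₁, h₂⟩
        by_cases h : x = s
        · exact .inl h
        · exact .inr ⟨h₁, h₂, h⟩
      · rintro (rfl | ⟨h₁, h₂, -⟩)
        · exact ⟨has.le, sup_eq_left.2 hbs⟩
        · exact ⟨h₁, h₂⟩
    rw [hins, Finset.sum_insert (by simp)] at hW
    have hpos : 0 < ∑ x with a ≤ x ∧ x ⊔ b = s ∧ x ≠ s, (-1) ^ n * f x := by
      refine Finset.sum_pos (fun x hx => ?_) ?_
      · simp only [Finset.mem_filter, Finset.mem_univ, true_and] at hx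
        have h := hcov x hx.1 hx.2.1 hx.2.2
        exact ih (hn.of_covBy hx.1 h) (hs.mono_right hx.1 h.le)
      · obtain ⟨y, hy₁, -, hy₃, hy₄⟩ := hs.2 b hab.le hbs
        refine ⟨y, ?_⟩
        simp only [Finset.mem_filter, Finset.mem_univ, true_and]
        refine ⟨hy₁, by rw [sup_comm, hy₄], ?_⟩
        rintro rfl
        rw [inf_eq_left.2 hbs] at hy₃
        exact hab.lt.ne' hy₃
    rw [← Finset.mul_sum] at hpos
    rw [eq_neg_of_add_eq_zero_left hW, pow_succ]
    linarith

theorem IsMoebius.ne_zero_of_isComplInterval {α : Type*} [Lattice α] [IsModularLattice α]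
    [Fintype α] {a : α} {f : α → ℤ} (hf : IsMoebius a f) {s : α} (hs : IsComplInterval a s) :
    f s ≠ 0 := by
  obtain ⟨n, hn⟩ := exists_hasCoverChain s hs.1
  intro h
  simpa [h] using hf.sign_of_isComplInterval hn hs

end Moebius

/-! ### Transport of complemented intervals and Loewy chains along isomorphisms onto initial
segments -/

section Transport

variable {α β : Type*} [Lattice α] [Lattice β] {t : β}

theorem isComplInterval_orderIso_iff (e : α ≃o Set.Iic t) {a s : α} :
    IsComplInterval (e a).1 (e s).1 ↔ IsComplInterval a s := by
  have hinf : ∀ x y, (e (x ⊓ y)).1 = (e x).1 ⊓ (e y).1 := fun x y => by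
    rw [e.map_inf, Set.Iic.coe_inf]
  have hsup : ∀ x y, (e (x ⊔ y)).1 = (e x).1 ⊔ (e y).1 := fun x y => by
    rw [e.map_sup, Set.Iic.coe_sup]
  have hle : ∀ {x y}, (e x).1 ≤ (e y).1 ↔ x ≤ y := e.le_iff_le
  have hinj : ∀ {x y}, (e x).1 = (e y).1 ↔ x = y := fun {x y} => by
    rw [← Subtype.ext_iff, e.injective.eq_iff]
  constructor
  · rintro ⟨h, h'⟩
    refine ⟨hle.1 h, fun x h₁ h₂ => ?_⟩
    obtain ⟨y, hy₁, hy₂, hy₃, hy₄⟩ := h' _ (hle.2 h₁) (hle.2 h₂)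
    obtain ⟨y, rfl⟩ : ∃ z, (e z).1 = y := ⟨e.symm ⟨y, hy₂.trans (e s).2⟩, by simp⟩
    rw [← hinf, hinj] at hy₃
    rw [← hsup, hinj] at hy₄
    exact ⟨y, hle.1 hy₁, hle.1 hy₂, hy₃, hy₄⟩
  · rintro ⟨h, h'⟩
    refine ⟨hle.2 h, fun x h₁ h₂ => ?_⟩
    obtain ⟨x, rfl⟩ : ∃ z, (e z).1 = x := ⟨e.symm ⟨x, h₂.trans (e s).2⟩, by simp⟩
    obtain ⟨y, hy₁, hy₂, hy₃, hy₄⟩ := h' x (hle.1 h₁) (hle.1 h₂)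
    exact ⟨(e y).1, hle.2 hy₁, hle.2 hy₂, by rw [← hinf, hy₃], by rw [← hsup, hy₄]⟩

theorem hasLoewyChain_orderIso_iff (e : α ≃o Set.Iic t) {k : ℕ} {a b : α} :
    HasLoewyChain k (e a).1 (e b).1 ↔ HasLoewyChain k a b := by
  induction k generalizing a with
  | zero =>
    change (e a).1 = (e b).1 ↔ a = b
    rw [← Subtype.ext_iff, e.injective.eq_iff]
  | succ k ih =>
    constructor
    · rintro ⟨s, hs, h⟩
      obtain ⟨s, rfl⟩ : ∃ z, (e z).1 = s := ⟨e.symm ⟨s, h.le.trans (e b).2⟩, by simp⟩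
      exact ⟨s, (isComplInterval_orderIso_iff e).1 hs, ih.1 h⟩
    · rintro ⟨s, hs, h⟩
      exact ⟨(e s).1, (isComplInterval_orderIso_iff e).2 hs, ih.2 h⟩

end Transport

/-! ### Isomorphism classes of quotients, epimorphism counts, simple epimorphisms and levels -/

section Classes

variable {C : Type u} [Category.{v} C]

theorem cls_eq_iff {G H : C} : cls G = cls H ↔ Nonempty (G ≅ H) :=
  Quotient.eq (r := isIsomorphicSetoid C)

@[simp]
theorem cls_rep (c : IsoClass C) : cls c.rep = c := Quotient.out_eq c

theorem quotCls_mk {G : C} {X : Cᵒᵖ} (f : X ⟶ Opposite.op G) [Mono f] :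
    quotCls (Subobject.mk f : QuotObj G) = cls X.unop :=
  cls_eq_iff.2 ⟨(Subobject.underlyingIso f).symm.unop⟩

theorem quotCls_quotMk {G F : C} (f : Epis G F) : quotCls (quotMk f) = cls F :=
  haveI : Epi f.1 := f.2
  quotCls_mk f.1.op

@[simp]
theorem quotCls_top (G : C) : quotCls (⊤ : QuotObj G) = cls G := by
  rw [Subobject.top_eq_id, quotCls_mk]

theorem exists_quotMk_eq {G F : C} {x : QuotObj G} (h : quotCls x = cls F) :
    ∃ f : Epis G F, quotMk f = x := by
  obtain ⟨i⟩ := cls_eq_iff.1 h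
  refine ⟨⟨x.arrow.unop ≫ i.hom, inferInstance⟩, ?_⟩
  refine Subobject.mk_eq_of_comm _ i.op ?_
  simp

/-- Quotients of a quotient of `G` are quotients of `G` below it. This moves statements about
representatives of different classes into the single lattice of quotients of `G`. -/
theorem exists_orderIso_Iic {G : C} (x : QuotObj G) {H : C} (h : quotCls x = cls H) :
    ∃ e : QuotObj H ≃o Set.Iic x, ∀ z, quotCls (e z).1 = quotCls z := by
  obtain ⟨i⟩ := cls_eq_iff.1 h
  refine ⟨(Subobject.mapIsoToOrderIso i.op).trans (Subobject.subobjectOrderIso x), fun z => ?_⟩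
  have h₁ : quotCls (((Subobject.mapIsoToOrderIso i.op).trans
      (Subobject.subobjectOrderIso x)) z).1 = cls (Opposite.unop
        (((Subobject.mapIsoToOrderIso i.op) z : Subobject (x : Cᵒᵖ)) : Cᵒᵖ)) :=
    quotCls_mk _
  rw [h₁]
  induction z using Subobject.ind with
  | _ f =>
  rw [quotCls_mk]
  exact quotCls_mk (G := Opposite.unop (x : Cᵒᵖ)) (f ≫ i.op.hom)

theorem orderIso_top {α β : Type*} [PartialOrder α] [OrderTop α] [PartialOrder β] {t : β}
    (e : α ≃o Set.Iic t) : (e ⊤).1 = t := by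
  rw [e.map_top]
  rfl

theorem exists_orderIso_rep {G : C} (x : QuotObj G) :
    ∃ e : QuotObj (quotCls x).rep ≃o Set.Iic x, ∀ z, quotCls (e z).1 = quotCls z :=
  exists_orderIso_Iic x (cls_rep _).symm

/-- Epimorphisms are pairs of a quotient and an automorphism of the target. -/
theorem card_epis (G F : C) :
    Nat.card (Epis G F) = Nat.card (Aut F) * Nat.card {x : QuotObj G // quotCls x = cls F} := by
  choose s hs using fun x : {x : QuotObj G // quotCls x = cls F} => exists_quotMk_eq x.2
  change _ = Nat.card (F ≅ F) * _
  rw [← Nat.card_prod]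
  symm
  refine Nat.card_congr (Equiv.ofBijective
    (fun p : (F ≅ F) × {x : QuotObj G // quotCls x = cls F} =>
      (⟨(s p.2).1 ≫ p.1.hom, haveI := (s p.2).2; epi_comp _ _⟩ : Epis G F)) ⟨?_, ?_⟩)
  · rintro ⟨a, x⟩ ⟨b, y⟩ h
    have h₁ : (s x).1 ≫ a.hom = (s y).1 ≫ b.hom := congrArg Subtype.val h
    have hxy : x = y := by
      refine Subtype.ext (le_antisymm ?_ ?_)
      · rw [← hs x, ← hs y, quotMk_le_quotMk_iff]
        exact ⟨b.hom ≫ a.inv, by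
          rw [← Category.assoc, ← h₁, Category.assoc, Iso.hom_inv_id, Category.comp_id]⟩
      · rw [← hs x, ← hs y, quotMk_le_quotMk_iff]
        exact ⟨a.hom ≫ b.inv, by
          rw [← Category.assoc, h₁, Category.assoc, Iso.hom_inv_id, Category.comp_id]⟩
    subst hxy
    have := (s x).2
    rw [cancel_epi] at h₁
    rw [Iso.ext h₁]
  · intro f
    let x : {x : QuotObj G // quotCls x = cls F} := ⟨quotMk f, quotCls_quotMk f⟩
    have h₁ := (quotMk_le_quotMk_iff f (s x)).1 (hs x).ge
    have h₂ := (quotMk_le_quotMk_iff (s x) f).1 (hs x).le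
    obtain ⟨k, hk⟩ := h₁
    obtain ⟨l, hl⟩ := h₂
    have := (s x).2
    have := f.2
    refine ⟨(⟨k, l, ?_, ?_⟩, x), Subtype.ext hk⟩
    · rw [← cancel_epi (s x).1, ← Category.assoc, hk, hl, Category.comp_id]
    · rw [← cancel_epi f.1, ← Category.assoc, hl, hk, Category.comp_id]

theorem IsSimpleEpi.comp_iso {G F F' : C} {f : G ⟶ F} (h : IsSimpleEpi f) (i : F ≅ F') :
    IsSimpleEpi (f ≫ i.hom) := by
  obtain ⟨h₁, h₂, h₃⟩ := h
  refine ⟨inferInstance, fun h => h₂ ?_, fun H g k hg hk hgk => ?_⟩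
  · exact IsIso.of_isIso_comp_right f i.hom
  · rcases h₃ H g (k ≫ i.inv) hg inferInstance (by rw [← Category.assoc, hgk]; simp) with h | h
    · exact .inl h
    · exact .inr (IsIso.of_isIso_comp_right k i.inv)

/-- A covering of quotients gives a simple epimorphism. -/
theorem exists_isSimpleEpi_of_covBy {G : C} {a b : QuotObj G} (h : a ⋖ b) :
    ∃ f : (Opposite.unop (b : Cᵒᵖ)) ⟶ Opposite.unop (a : Cᵒᵖ), IsSimpleEpi f := by
  refine ⟨(Subobject.ofLE a b h.le).unop, inferInstance, fun hi => h.lt.ne ?_, ?_⟩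
  · have : IsIso (Subobject.ofLE a b h.le) := (isIso_unop_iff _).1 hi
    exact Subobject.eq_of_comm (asIso (Subobject.ofLE a b h.le)) (by simp)
  · intro H g k hg hk hgk
    have hgk' : k.op ≫ g.op = Subobject.ofLE a b h.le := by rw [← op_comp, hgk]; rfl
    have h₁ : Subobject.mk (g.op ≫ b.arrow) ≤ b := Subobject.mk_le_of_comm g.op rfl
    have h₂ : a ≤ Subobject.mk (g.op ≫ b.arrow) :=
      Subobject.le_mk_of_comm k.op (by rw [← Category.assoc, hgk', Subobject.ofLE_arrow])
    rcases h.eq_or_eq h₂ h₁ with h₃ | h₃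
    · right
      rw [← isIso_op_iff]
      have he : k.op = (Subobject.isoOfEqMk a _ h₃.symm).hom := by
        rw [← cancel_mono (g.op ≫ b.arrow), ← Category.assoc, hgk', Subobject.ofLE_arrow]
        simp [Subobject.isoOfEqMk]
      rw [he]
      infer_instance
    · left
      rw [← isIso_op_iff]
      have he : g.op = (Subobject.isoOfMkEq _ b h₃).hom := by
        rw [← cancel_mono b.arrow]
        simp [Subobject.isoOfMkEq]
      rw [he]
      infer_instance

theorem Level.exists_finset (L : Level C) : ∃ B : Finset (IsoClass C), L = levelOf B := by
  obtain ⟨L, B, hB, rfl⟩ := L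
  exact ⟨hB.toFinset, Subtype.ext (by simp [levelOf])⟩

theorem isFormation_generate (B : Set (IsoClass C)) : IsFormation (generate B) where
  downward G x h := by
    intro W hW
    exact hW.1.downward G x (h W hW)
  join G x y z hz hx hy := by
    intro W hW
    exact hW.1.join G x y z hz (hx W hW) (hy W hW)
  minimal c hc := by
    intro W hW
    exact hW.1.minimal hc

theorem subset_generate (B : Set (IsoClass C)) : B ⊆ generate B := fun _ h _ hW => hW.2 h

theorem generate_subset {B W : Set (IsoClass C)} (hW : IsFormation W) (h : B ⊆ W) :
    generate B ⊆ W := fun _ hc => hc W ⟨hW, h⟩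

theorem Level.isFormation (L : Level C) : IsFormation L.1 := by
  obtain ⟨L, B, hB, rfl⟩ := L
  exact isFormation_generate B

theorem levelOf_subset_iff {B : Finset (IsoClass C)} (L : Level C) :
    (levelOf B).1 ⊆ L.1 ↔ (B : Set (IsoClass C)) ⊆ L.1 :=
  ⟨(subset_generate _).trans, generate_subset L.isFormation⟩

theorem mem_levelOf {B : Finset (IsoClass C)} {c : IsoClass C} (h : c ∈ B) : c ∈ (levelOf B).1 :=
  subset_generate _ h

/-- The number of quotients of `H` of class `G`. -/
def quotCount (H G : IsoClass C) : ℕ := Nat.card {x : QuotObj H.rep // quotCls x = G}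

theorem card_epis_rep (H : IsoClass C) (G : C) :
    Nat.card (Epis H.rep G) = Nat.card (Aut G) * quotCount H (cls G) := card_epis _ _

end Classes

/-! ### Maximal quotients, Möbius inversion and bounded Loewy length in diamond categories -/

section Diamond

variable {C : Type u} [Category.{v} C] [DiamondCategory C]

instance (G : C) : Fintype (QuotObj G) := Fintype.ofFinite _

instance (G : C) : Finite (Aut G) := DiamondCategory.finite_aut G

instance (G : C) : IsModularLattice (QuotObj G) where
  sup_inf_le_assoc_of_le {x} y {z} hxz := by
    have hL := (DiamondCategory.modular_lattice G).choose_spec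
    have h := @IsModularLattice.sup_inf_le_assoc_of_le _ _ hL.2 x y z ((hL.1 _ _).2 hxz)
    exact (hL.1 _ _).1 h

theorem isMoebius_moebius {G : C} (a : QuotObj G) : IsMoebius a (moebius a) where
  self := by
    classical
    let _ : LocallyFiniteOrder (QuotObj G) := Fintype.toLocallyFiniteOrder
    exact IncidenceAlgebra.mu_self a
  sum b hab := by
    classical
    unfold moebius
    let _ : LocallyFiniteOrder (QuotObj G) := Fintype.toLocallyFiniteOrder
    have h := IncidenceAlgebra.sum_Icc_mu_right (𝕜 := ℤ) a b
    rw [if_neg hab.ne] at h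
    rw [← h]
    refine Finset.sum_congr ?_ fun x _ => ?_
    · ext x
      simp
    · congr!

/-- The least quotient of `G` is a minimal object, hence lies in `W`; a maximal quotient in `W` is
then greatest because `W` is closed under joins. -/
theorem IsFormation.exists_isGreatest {W : Set (IsoClass C)} (hW : IsFormation W) (G : C) :
    ∃ x, IsGreatest {y : QuotObj G | quotCls y ∈ W} x := by
  have hne : Set.Nonempty {y : QuotObj G | quotCls y ∈ W} := by
    obtain ⟨b, hb⟩ : ∃ b : QuotObj G, ∀ x, b ≤ x := by
      obtain ⟨b, hb⟩ := (Set.toFinite (Set.univ : Set (QuotObj G))).exists_minimal ⟨⊤, trivial⟩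
      exact ⟨b, fun x => inf_eq_left.1 (hb.eq_of_le trivial inf_le_left)⟩
    refine ⟨b, hW.minimal ⟨_, cls_rep _, fun z => ?_⟩⟩
    obtain ⟨e, -⟩ := exists_orderIso_rep b
    exact e.injective (Subtype.ext (le_antisymm ((e z).2.trans (hb _)) ((e ⊤).2.trans (hb _))))
  obtain ⟨x, hx⟩ := (Set.toFinite {y : QuotObj G | quotCls y ∈ W}).exists_maximal hne
  refine ⟨x, hx.prop, fun y hy => ?_⟩
  have h : quotCls (x ⊔ y) ∈ W := hW.join G x y _ isLUB_pair hx.prop hy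
  exact le_sup_right.trans (hx.le_of_ge h le_sup_left)

open Classical in
/-- The class of the maximal quotient lying in `W`. -/
def maxQuot (W : Set (IsoClass C)) (c : IsoClass C) : IsoClass C :=
  if h : ∃ x : QuotObj c.rep, IsGreatest {y : QuotObj c.rep | quotCls y ∈ W} x then
    quotCls h.choose else c

theorem IsFormation.maxQuot_eq {W : Set (IsoClass C)} (hW : IsFormation W) {G : C}
    {x : QuotObj G} (hx : IsGreatest {y : QuotObj G | quotCls y ∈ W} x) :
    maxQuot W (cls G) = quotCls x := by
  have h := hW.exists_isGreatest (cls G).rep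
  rw [maxQuot, dif_pos h]
  obtain ⟨e, he⟩ := exists_orderIso_Iic (⊤ : QuotObj G) (H := (cls G).rep) (by simp)
  have hg := h.choose_spec
  rw [← he]
  congr 1
  refine le_antisymm (hx.2 ?_) ?_
  · change quotCls (e _).1 ∈ W
    rw [he]
    exact hg.1
  · have h₁ : e.symm ⟨x, Set.mem_Iic.2 le_top⟩ ≤ h.choose := by
      refine hg.2 ?_
      change quotCls _ ∈ W
      rw [← he]
      simpa using hx.1
    rw [OrderIso.symm_apply_le] at h₁
    exact h₁

theorem IsFormation.isMaximalQuotient_iff {W : Set (IsoClass C)} (hW : IsFormation W)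
    {c d : IsoClass C} : IsMaximalQuotient W c d ↔ d = maxQuot W c := by
  constructor
  · rintro ⟨G, x, rfl, hx, rfl⟩
    exact (hW.maxQuot_eq hx).symm
  · rintro rfl
    obtain ⟨x, hx⟩ := hW.exists_isGreatest c.rep
    refine ⟨c.rep, x, cls_rep c, hx, ?_⟩
    rw [← hW.maxQuot_eq hx, cls_rep]

theorem IsFormation.maxQuot_mem {W : Set (IsoClass C)} (hW : IsFormation W) (c : IsoClass C) :
    maxQuot W c ∈ W := by
  obtain ⟨x, hx⟩ := hW.exists_isGreatest c.rep
  have h := hW.maxQuot_eq hx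
  rw [cls_rep] at h
  exact h ▸ hx.1

theorem IsFormation.maxQuot_of_mem {W : Set (IsoClass C)} (hW : IsFormation W) {c : IsoClass C}
    (hc : c ∈ W) : maxQuot W c = c := by
  have h : IsGreatest {y : QuotObj c.rep | quotCls y ∈ W} ⊤ := ⟨by simpa using hc, fun _ _ => le_top⟩
  have h' := hW.maxQuot_eq h
  rwa [quotCls_top, cls_rep] at h'

theorem IsFormation.maxQuot_maxQuot {W W' : Set (IsoClass C)} (hW : IsFormation W)
    (hW' : IsFormation W') (h : W ⊆ W') (c : IsoClass C) :
    maxQuot W (maxQuot W' c) = maxQuot W c := by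
  obtain ⟨x, hx⟩ := hW.exists_isGreatest c.rep
  obtain ⟨y, hy⟩ := hW'.exists_isGreatest c.rep
  have h₁ := hW.maxQuot_eq hx
  have h₂ := hW'.maxQuot_eq hy
  rw [cls_rep] at h₁ h₂
  rw [h₁, h₂]
  obtain ⟨e, he⟩ := exists_orderIso_rep y
  have hxy : x ≤ y := hy.2 (h hx.1)
  have hg : IsGreatest {z : QuotObj (quotCls y).rep | quotCls z ∈ W} (e.symm ⟨x, hxy⟩) := by
    constructor
    · change quotCls _ ∈ W
      rw [← he]
      simpa using hx.1
    · intro z hz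
      rw [OrderIso.le_symm_apply]
      refine hx.2 ?_
      change quotCls _ ∈ W
      rwa [he]
  have h₃ := hW.maxQuot_eq hg
  rw [cls_rep] at h₃
  rw [h₃, ← he]
  simp

open Classical in
theorem quotCount_eq_card (H G : IsoClass C) :
    quotCount H G = (Finset.univ.filter fun x : QuotObj H.rep => quotCls x = G).card := by
  rw [quotCount, Nat.card_eq_fintype_card, Fintype.card_subtype]

open Classical in
theorem quotCount_quotCls {G : C} (x : QuotObj G) (c : IsoClass C) :
    quotCount (quotCls x) c
      = (Finset.univ.filter fun y : QuotObj G => y ≤ x ∧ quotCls y = c).card := by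
  obtain ⟨e, he⟩ := exists_orderIso_rep x
  rw [quotCount_eq_card]
  refine Finset.card_bij (fun z _ => (e z).1) ?_ ?_ ?_
  · intro z hz
    simp only [Finset.mem_filter, Finset.mem_univ, true_and] at hz ⊢
    exact ⟨(e z).2, (he z).trans hz⟩
  · intro y _ z _ h
    exact e.injective (Subtype.ext h)
  · intro y hy
    simp only [Finset.mem_filter, Finset.mem_univ, true_and] at hy
    refine ⟨e.symm ⟨y, hy.1⟩, ?_, by simp⟩
    simp only [Finset.mem_filter, Finset.mem_univ, true_and]
    rw [← he]
    simpa using hy.2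

/-- All quotients with class in `W` lie below the maximal one. Hence moments of objects of a level
depend only on the weights at that level. -/
theorem quotCount_maxQuot {W : Set (IsoClass C)} (hW : IsFormation W) (H : IsoClass C)
    {G : IsoClass C} (hG : G ∈ W) : quotCount (maxQuot W H) G = quotCount H G := by
  classical
  obtain ⟨x, hx⟩ := hW.exists_isGreatest H.rep
  have h₁ := hW.maxQuot_eq hx
  rw [cls_rep] at h₁
  rw [h₁, quotCount_quotCls, quotCount_eq_card]
  congr 1
  ext y
  simp only [Finset.mem_filter, Finset.mem_univ, true_and, and_iff_right_iff_imp]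
  rintro rfl
  exact hx.2 hG

theorem quotCount_self_pos (G : IsoClass C) : 0 < quotCount G G := by
  have : Nonempty {x : QuotObj G.rep // quotCls x = G} := ⟨⟨⊤, by simp⟩⟩
  exact Nat.card_pos

/-- `∑ |μ(y)|` over the quotients `y` of `H` of class `G`. -/
def absMu (G H : IsoClass C) : ℕ :=
  ∑ᶠ y : {y : QuotObj H.rep // quotCls y = G}, (moebius y.1 ⊤).natAbs

open Classical in
theorem absMu_eq_sum (G H : IsoClass C) : absMu G H
    = ∑ y : QuotObj H.rep with quotCls y = G, (moebius y ⊤).natAbs := by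
  rw [absMu, finsum_eq_sum_of_fintype]
  symm
  refine Finset.sum_subtype _ (fun y => ?_) _
  simp

open Classical in
theorem muHat_eq_sum (F : IsoClass C) (G : C) : muHat F G
    = ∑ y : QuotObj G with quotCls y = F, moebius y ⊤ := by
  rw [muHat, finsum_eq_sum_of_fintype]
  symm
  refine Finset.sum_subtype _ (fun y => ?_) _
  simp

theorem abs_muHat_le (F G : IsoClass C) : |muHat F G.rep| ≤ absMu F G := by
  classical
  rw [muHat_eq_sum, absMu_eq_sum]
  refine (Finset.abs_sum_le_sum_abs _ _).trans ?_
  push_cast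
  rfl

open Classical in
/-- A sum of Möbius values over the quotients of `quotCls x` is a sum over the quotients below
`x`. -/
theorem sum_moebius_rep {G : C} (x : QuotObj G) (F : IsoClass C) {R : Type*} [AddCommMonoid R]
    (φ : ℤ → R) :
    ∑ z : QuotObj (quotCls x).rep with quotCls z = F, φ (moebius z ⊤)
      = ∑ y : QuotObj G with y ≤ x ∧ quotCls y = F, φ (moebius y x) := by
  obtain ⟨e, he⟩ := exists_orderIso_rep x
  refine Finset.sum_bij (fun z _ => (e z).1) ?_ ?_ ?_ ?_
  · intro z hz
    simp only [Finset.mem_filter, Finset.mem_univ, true_and] at hz ⊢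
    exact ⟨(e z).2, (he z).trans hz⟩
  · intro y _ z _ h
    exact e.injective (Subtype.ext h)
  · intro y hy
    simp only [Finset.mem_filter, Finset.mem_univ, true_and] at hy
    refine ⟨e.symm ⟨y, hy.1⟩, ?_, by simp⟩
    simp only [Finset.mem_filter, Finset.mem_univ, true_and]
    rw [← he, e.apply_symm_apply]
    exact hy.2
  · intro z _
    have h := (isMoebius_moebius z).comp_orderIso e (isMoebius_moebius (e z).1) (b := ⊤) le_top
    rw [orderIso_top] at h
    rw [h]

/-- Möbius inversion over the quotients of `H`. -/
theorem sum_muHat (F H : IsoClass C) [Decidable (H = F)] :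
    ∑ x : QuotObj H.rep, muHat F (quotCls x).rep = if H = F then 1 else 0 := by
  classical
  have h₁ : ∀ x : QuotObj H.rep, muHat F (quotCls x).rep
      = ∑ y : QuotObj H.rep with quotCls y = F, if y ≤ x then moebius y x else 0 := by
    intro x
    rw [muHat_eq_sum, ← Finset.sum_filter, Finset.filter_filter]
    refine (sum_moebius_rep x F id).trans (Finset.sum_congr ?_ fun _ _ => rfl)
    ext y
    simp [and_comm]
  simp only [h₁]
  rw [Finset.sum_comm]
  have h₂ : ∀ y : QuotObj H.rep, (∑ x, if y ≤ x then moebius y x else 0)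
      = if y = ⊤ then 1 else 0 := by
    intro y
    rw [← Finset.sum_filter]
    split_ifs with h
    · subst h
      simp only [top_le_iff]
      rw [Finset.sum_filter, Finset.sum_ite_eq' Finset.univ ⊤, if_pos (Finset.mem_univ _),
        (isMoebius_moebius _).self]
    · rw [← (isMoebius_moebius y).sum ⊤ (lt_top_iff_ne_top.2 h)]
      simp
  simp only [h₂]
  rw [Finset.sum_ite_eq']
  simp

/-- Regrouping a sum over quotients by their classes. -/
theorem hasSum_quotCount {R : Type*} [NonAssocSemiring R] [TopologicalSpace R] (H : IsoClass C)
    (φ : IsoClass C → R) (s : Set (IsoClass C)) (hs : ∀ x : QuotObj H.rep, quotCls x ∈ s) :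
    HasSum (fun G : s => (quotCount H G : R) * φ G) (∑ x : QuotObj H.rep, φ (quotCls x)) := by
  classical
  let t : Finset s := Finset.univ.image fun x : QuotObj H.rep => (⟨quotCls x, hs x⟩ : s)
  have h : ∑ x : QuotObj H.rep, φ (quotCls x) = ∑ G ∈ t, (quotCount H G : R) * φ G := by
    rw [← Finset.sum_fiberwise_of_maps_to (t := t)
      (g := fun x : QuotObj H.rep => (⟨quotCls x, hs x⟩ : s))
      (fun x _ => Finset.mem_image_of_mem _ (Finset.mem_univ x))]
    refine Finset.sum_congr rfl fun G _ => ?_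
    rw [quotCount_eq_card, ← nsmul_eq_mul, ← Finset.sum_const]
    refine Finset.sum_congr ?_ fun x hx => ?_
    · ext x
      simp [Subtype.ext_iff]
    · simp only [Finset.mem_filter, Finset.mem_univ, true_and] at hx
      rw [hx]
  rw [h]
  refine hasSum_sum_of_ne_finset_zero fun G hG => ?_
  have : quotCount H G = 0 := by
    rw [quotCount_eq_card, Finset.card_eq_zero, Finset.filter_eq_empty_iff]
    intro x _ hx
    exact hG (Finset.mem_image.2 ⟨x, Finset.mem_univ x, Subtype.ext hx⟩)
  simp [this]

/-- In a level, the Loewy length of the lattices of quotients is bounded. -/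
theorem Level.exists_hasLoewyChain (L : Level C) :
    ∃ k, ∀ H ∈ L.1, ∀ a : QuotObj (IsoClass.rep H), HasLoewyChain k a ⊤ := by
  obtain ⟨L, B, hB, rfl⟩ := L
  have h₁ : ∀ c : IsoClass C, ∃ k, ∀ a : QuotObj c.rep, HasLoewyChain k a ⊤ := by
    intro c
    obtain ⟨k, hk⟩ := exists_forall_hasLoewyChain (⊤ : QuotObj c.rep)
    exact ⟨k, fun a => hk a le_top⟩
  choose k hk using h₁
  obtain ⟨K, hK⟩ := (hB.image k).bddAbove
  have key : ∀ {G : C} (x : QuotObj G),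
      (∀ a : QuotObj (quotCls x).rep, HasLoewyChain K a ⊤) ↔ ∀ a ≤ x, HasLoewyChain K a x := by
    intro G x
    obtain ⟨e, -⟩ := exists_orderIso_rep x
    constructor
    · intro h a ha
      have h₂ := (hasLoewyChain_orderIso_iff e).2 (h (e.symm ⟨a, ha⟩))
      rwa [orderIso_top, e.apply_symm_apply] at h₂
    · intro h a
      have h₂ := h (e a).1 (e a).2
      refine (hasLoewyChain_orderIso_iff e).1 ?_
      rwa [orderIso_top]
  -- The classes of Loewy length at most `K` form a formation containing `B`, hence contain the
  -- whole level.
  refine ⟨K, generate_subset (W := {c : IsoClass C | ∀ a : QuotObj c.rep, HasLoewyChain K a ⊤})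
    ⟨?_, ?_, ?_⟩ ?_⟩
  · intro G x hG
    rw [← quotCls_top] at hG
    refine (key x).2 fun a ha => ?_
    have h := ((key _).1 hG a le_top).inf_const x
    rwa [inf_eq_left.2 ha, top_inf_eq] at h
  · intro G x y z hz hx hy
    obtain rfl : x ⊔ y = z := isLUB_pair.unique hz
    refine (key _).2 fun a ha => ?_
    -- Join three chains: from `a ⊓ x` to `x`, from `a ⊓ y` to `y`, and the constant chain at `a`.
    -- The result runs from `a` to `x ⊔ y` without becoming longer.
    have h₁ := (key _).1 hx (a ⊓ x) inf_le_right
    have h₂ := (key _).1 hy (a ⊓ y) inf_le_right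
    have h₃ := (h₁.sup h₂).sup (HasLoewyChain.refl K a)
    rwa [sup_eq_right.2 (sup_le inf_le_left inf_le_left), sup_eq_left.2 ha] at h₃
  · rintro _ ⟨G, rfl, hG⟩ a
    obtain ⟨e, -⟩ := exists_orderIso_Iic (⊤ : QuotObj G) (H := (cls G).rep) (by simp)
    have : a = ⊤ := e.injective (Subtype.ext ((hG _).trans (hG _).symm))
    rw [this]
    exact .refl _ _
  · intro c hc a
    exact (hk c a).mono (hK ⟨c, hc, rfl⟩)

theorem Level.finite_simple (L : Level C) (c : IsoClass C) (hc : c ∈ L.1) :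
    {d | d ∈ L.1 ∧ ∃ (G : C) (a b : QuotObj G), a ⋖ b ∧ quotCls a = c ∧ quotCls b = d}.Finite := by
  refine (DiamondCategory.finite_simple L c.rep (by rwa [cls_rep])).subset ?_
  rintro d ⟨hd, G, a, b, hab, rfl, rfl⟩
  obtain ⟨f, hf⟩ := exists_isSimpleEpi_of_covBy hab
  obtain ⟨i⟩ := cls_eq_iff.1 (cls_rep (quotCls a)).symm
  exact ⟨hd, _, f ≫ i.hom, rfl, hf.comp_iso i⟩

end Diamond

/-! ### Weights on one level: uniqueness, no escape of mass, convergence -/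

section Moments

variable {C : Type u} [Category.{v} C] [DiamondCategory C]

/-- `p` is a weight function on `W` whose moments, divided by the orders of the automorphism
groups, are given by `m`. -/
structure HasNormalizedMoments (W : Set (IsoClass C)) (p m : IsoClass C → ℝ≥0∞) : Prop where
  support : ∀ H, H ∉ W → p H = 0
  tsum_eq : ∀ G ∈ W, ∑' H, p H * quotCount H G = m G

/-- The Möbius sums of `m` converge absolutely on `W`. -/
structure IsMoebiusSummable (W : Set (IsoClass C)) (m : IsoClass C → ℝ≥0∞) : Prop where
  ne_top : ∀ G ∈ W, m G ≠ ∞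
  tsum_ne_top : ∀ F ∈ W, ∑' G : W, (absMu F G : ℝ≥0∞) * m G ≠ ∞

theorem HasNormalizedMoments.ne_top {W : Set (IsoClass C)} {p m : IsoClass C → ℝ≥0∞}
    (hp : HasNormalizedMoments W p m) (hm : IsMoebiusSummable W m) (H : IsoClass C) :
    p H ≠ ∞ := by
  by_cases hH : H ∈ W
  · refine ne_top_of_le_ne_top (hm.ne_top H hH) ?_
    rw [← hp.tsum_eq H hH]
    refine le_trans ?_ (ENNReal.le_tsum H)
    exact le_mul_of_one_le_right zero_le (by exact_mod_cast quotCount_self_pos H)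
  · simp [hp.support H hH]

/-- Möbius inversion: a weight function is determined by its moments. -/
theorem HasNormalizedMoments.hasSum {W : Set (IsoClass C)} (hW : IsFormation W)
    {p m : IsoClass C → ℝ≥0∞} (hp : HasNormalizedMoments W p m) (hm : IsMoebiusSummable W m)
    {F : IsoClass C} (hF : F ∈ W) :
    HasSum (fun G : W => (muHat F G.1.rep : ℝ) * (m G).toReal) (p F).toReal := by
  classical
  have hfin := hp.ne_top hm
  -- Both iterated sums of this absolutely summable family are evaluated: over `G` first, Möbius
  -- inversion leaves only `p F`; over `H` first, the moments appear.
  let f : IsoClass C × W → ℝ := fun x =>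
    (muHat F x.2.1.rep : ℝ) * ((p x.1).toReal * quotCount x.1 x.2)
  have hf : Summable f := by
    have h₁ : ∑' x : IsoClass C × W, (absMu F x.2 : ℝ≥0∞) * (p x.1 * quotCount x.1 x.2) ≠ ∞ := by
      rw [ENNReal.tsum_prod', ENNReal.tsum_comm]
      refine ne_of_eq_of_ne (tsum_congr fun G => ?_) (hm.tsum_ne_top F hF)
      change ∑' H, (absMu F G : ℝ≥0∞) * (p H * quotCount H G) = _
      rw [ENNReal.tsum_mul_left, hp.tsum_eq G G.2]
    refine Summable.of_norm_bounded (ENNReal.summable_toReal h₁) fun x => ?_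
    rw [Real.norm_eq_abs, abs_mul, ENNReal.toReal_mul, ENNReal.toReal_mul, ENNReal.toReal_natCast,
      ENNReal.toReal_natCast, abs_of_nonneg (a := (p x.1).toReal * _) (by positivity)]
    gcongr
    exact_mod_cast abs_muHat_le F x.2.1
  have h₁ : HasSum (fun H : IsoClass C => if H = F then (p F).toReal else 0) (∑' x, f x) := by
    refine hf.hasSum.prod_fiberwise fun H => ?_
    by_cases hH : H ∈ W
    · have h := (hasSum_quotCount (R := ℝ) H (fun G => (muHat F G.rep : ℝ)) W
        (fun x => hW.downward _ x (by rwa [cls_rep]))).mul_left (p H).toReal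
      have h₁ : (fun G : W => f (H, G))
          = fun G : W => (p H).toReal * ((quotCount H G : ℝ) * (muHat F G.1.rep : ℝ)) := by
        funext G
        simp only [f]
        ring
      have h₂ : (if H = F then (p F).toReal else 0)
          = (p H).toReal * ∑ x : QuotObj H.rep, (muHat F (quotCls x).rep : ℝ) := by
        rw [← Int.cast_sum, sum_muHat F H]
        split_ifs with hHF
        · simp [hHF]
        · simp
      rw [h₁, h₂]
      exact h
    · have hHF : H ≠ F := fun h => hH (h ▸ hF)
      simp [f, hp.support H hH, hHF]
  have h₂ : HasSum (fun G : W => (muHat F G.1.rep : ℝ) * (m G).toReal) (∑' x, f x) := by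
    have h := (Equiv.prodComm W (IsoClass C)).hasSum_iff.2 hf.hasSum
    refine h.prod_fiberwise fun G => ?_
    refine HasSum.mul_left _ ?_
    rw [← hp.tsum_eq G G.2]
    have hne : ∑' H, p H * quotCount H G ≠ ∞ := hp.tsum_eq G G.2 ▸ hm.ne_top G G.2
    have h' := ENNReal.hasSum_toReal hne
    rw [ENNReal.tsum_toReal_eq fun H => ENNReal.ne_top_of_tsum_ne_top hne H]
    simpa [ENNReal.toReal_mul] using h'
  have h₃ := h₁.unique (hasSum_ite_eq F (p F).toReal)
  rwa [h₃] at h₂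

theorem HasNormalizedMoments.unique {W : Set (IsoClass C)} (hW : IsFormation W)
    {p q m : IsoClass C → ℝ≥0∞} (hp : HasNormalizedMoments W p m)
    (hq : HasNormalizedMoments W q m) (hm : IsMoebiusSummable W m) : p = q := by
  funext F
  by_cases hF : F ∈ W
  · exact (ENNReal.toReal_eq_toReal_iff' (hp.ne_top hm F) (hq.ne_top hm F)).1
      ((hp.hasSum hW hm hF).unique (hq.hasSum hW hm hF))
  · rw [hp.support F hF, hq.support F hF]

open Classical in
/-- The number of quotients of `H` of class `G` over which `H` has Loewy length at most `k`. -/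
def loewyCount (k : ℕ) (H G : IsoClass C) : ℕ :=
  (Finset.univ.filter fun x : QuotObj H.rep => HasLoewyChain k x ⊤ ∧ quotCls x = G).card

theorem sum_mul_card_filter {ι κ : Type*} [Fintype ι] [DecidableEq κ] (T : Finset κ) (φ : κ → ℕ)
    (f : ι → κ) (P : ι → Prop) [DecidablePred P] :
    ∑ x ∈ T, φ x * (Finset.univ.filter fun i => P i ∧ f i = x).card
      = ∑ i with P i ∧ f i ∈ T, φ (f i) := by
  rw [← Finset.sum_fiberwise_of_maps_to (t := T) (g := f) (by simp)]
  refine Finset.sum_congr rfl fun x hx => ?_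
  rw [mul_comm, ← smul_eq_mul, ← Finset.sum_const]
  refine Finset.sum_congr ?_ fun i hi => ?_
  · ext i
    simp only [Finset.mem_filter, Finset.mem_univ, true_and]
    constructor
    · rintro ⟨h, rfl⟩
      exact ⟨⟨h, hx⟩, rfl⟩
    · rintro ⟨⟨h, -⟩, rfl⟩
      exact ⟨h, rfl⟩
  · simp only [Finset.mem_filter, Finset.mem_univ, true_and] at hi
    rw [hi.2]

theorem exists_covBy_of_mem_of_not_mem {α : Type*} [PartialOrder α] [Finite α] {P : α → Prop}
    {a s : α} (has : a ≤ s) (ha : P a) (hs : ¬ P s) :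
    ∃ b c, a ≤ b ∧ b ⋖ c ∧ c ≤ s ∧ P b ∧ ¬ P c := by
  obtain ⟨b, hb⟩ := (Set.toFinite {b | a ≤ b ∧ b ≤ s ∧ P b}).exists_maximal ⟨a, le_rfl, has, ha⟩
  have hbs : b < s := lt_of_le_of_ne hb.prop.2.1 fun h => hs (h ▸ hb.prop.2.2)
  obtain ⟨c, hbc, hcs⟩ := exists_covBy_le_of_lt hbs
  refine ⟨b, c, hb.prop.1, hbc, hcs, hb.prop.2.2, fun hc => ?_⟩
  exact hbc.lt.not_ge (hb.le_of_ge ⟨hb.prop.1.trans hbc.le, hcs, hc⟩ hbc.le)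

/-- For a quotient `a` of class `G`, let `s` be the end of its first layer. If `s` has class in `T`,
then `a` is counted in the first sum. Otherwise a cover inside `[a, s]` leaves `T` at some `c` with
class in `D`, and `a` is counted in the second sum. -/
theorem loewyCount_succ_le (k : ℕ) (H G : IsoClass C) (T D : Finset (IsoClass C)) (hG : G ∈ T)
    (hD : ∀ a b : QuotObj H.rep, a ⋖ b → quotCls a ∈ T → quotCls b ∉ T → quotCls b ∈ D) :
    loewyCount (k + 1) H G ≤ ∑ x ∈ T, quotCount x G * loewyCount k H x
      + ∑ x ∈ D, absMu G x * quotCount H x := by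
  classical
  have hA : ∑ x ∈ T, quotCount x G * loewyCount k H x
      = ∑ a : QuotObj H.rep with quotCls a = G, ∑ s : QuotObj H.rep,
        if a ≤ s ∧ HasLoewyChain k s ⊤ ∧ quotCls s ∈ T then 1 else 0 := by
    rw [Finset.sum_comm]
    unfold loewyCount
    rw [sum_mul_card_filter, Finset.sum_filter]
    refine Finset.sum_congr rfl fun s _ => ?_
    rw [quotCount_quotCls, Finset.card_eq_sum_ones]
    split_ifs with h
    · simp only [h, and_self, and_true]
      rw [← Finset.sum_filter, Finset.filter_filter]
      simp only [and_comm]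
    · simp [h]
  have hB : ∑ x ∈ D, absMu G x * quotCount H x
      = ∑ a : QuotObj H.rep with quotCls a = G, ∑ s : QuotObj H.rep,
        if a ≤ s ∧ quotCls s ∈ D then (moebius a s).natAbs else 0 := by
    rw [Finset.sum_comm]
    have h := sum_mul_card_filter D (absMu G) (quotCls : QuotObj H.rep → _) (fun _ => True)
    simp only [true_and] at h
    simp only [quotCount_eq_card, h, Finset.sum_filter (p := fun s : QuotObj H.rep => quotCls s ∈ D)]
    refine Finset.sum_congr rfl fun s _ => ?_
    split_ifs with h
    · simp only [h, and_true]
      rw [absMu_eq_sum, sum_moebius_rep s G Int.natAbs, ← Finset.sum_filter, Finset.filter_filter]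
      simp only [and_comm]
    · simp [h]
  rw [hA, hB, ← Finset.sum_add_distrib]
  have hL : loewyCount (k + 1) H G = ∑ a : QuotObj H.rep with quotCls a = G,
      if HasLoewyChain (k + 1) a ⊤ then 1 else 0 := by
    rw [← Finset.sum_filter, Finset.filter_filter, ← Finset.card_eq_sum_ones, loewyCount]
    simp only [and_comm]
  rw [hL]
  refine Finset.sum_le_sum fun a ha => ?_
  simp only [Finset.mem_filter, Finset.mem_univ, true_and] at ha
  split_ifs with h
  · obtain ⟨s, has, hs⟩ := h
    by_cases hsT : quotCls s ∈ T
    · refine le_trans ?_ (Nat.le_add_right _ _)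
      refine le_trans ?_ (Finset.single_le_sum (fun _ _ => Nat.zero_le _) (Finset.mem_univ s))
      rw [if_pos ⟨has.1, hs, hsT⟩]
    · obtain ⟨b, c, hab, hbc, hcs, hb, hc⟩ :=
        exists_covBy_of_mem_of_not_mem (P := fun x => quotCls x ∈ T) has.1 (ha ▸ hG) hsT
      have hac : a ≤ c := hab.trans hbc.le
      refine le_trans ?_ (Nat.le_add_left _ _)
      refine le_trans ?_ (Finset.single_le_sum (fun _ _ => Nat.zero_le _) (Finset.mem_univ c))
      rw [if_pos ⟨hac, hD b c hbc hb hc⟩]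
      -- `[a, c]` is complemented as an initial part of `[a, s]`, so `μ(a, c)` is a nonzero integer
      -- and contributes at least 1.
      exact Int.natAbs_pos.2
        ((isMoebius_moebius a).ne_zero_of_isComplInterval (has.mono_right hac hcs))
  · exact Nat.zero_le _

open Classical in
/-- No mass, weighted by the number of quotients of class `G`, escapes to infinity: the case of
bounded Loewy length. -/
theorem exists_finset_loewyCount_le (L : Level C) {ι : Type*} {l : Filter ι}
    {p : ι → IsoClass C → ℝ≥0∞} {m : IsoClass C → ℝ≥0∞} (hsupp : ∀ i H, H ∉ L.1 → p i H = 0)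
    (hlim : ∀ G ∈ L.1, Tendsto (fun i => ∑' H, p i H * quotCount H G) l (𝓝 (m G)))
    (hm : IsMoebiusSummable L.1 m) (k : ℕ) :
    ∀ G ∈ L.1, ∀ ε : ℝ≥0∞, ε ≠ 0 → ∃ A : Finset (IsoClass C), ∀ᶠ i in l,
      ∑' H, (if H ∈ A then 0 else p i H * loewyCount k H G) ≤ ε := by
  induction k with
  | zero =>
    intro G _ ε _
    refine ⟨{G}, Eventually.of_forall fun i => ?_⟩
    have h : ∀ H, (if H ∈ ({G} : Finset (IsoClass C)) then 0
        else p i H * loewyCount 0 H G) = 0 := by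
      intro H
      split_ifs with hH
      · rfl
      · have : loewyCount 0 H G = 0 := by
          rw [loewyCount, Finset.card_eq_zero, Finset.filter_eq_empty_iff]
          rintro x - ⟨h, hx⟩
          obtain rfl : x = ⊤ := h
          rw [quotCls_top, cls_rep] at hx
          exact hH (by simp [hx])
        simp [this]
    rw [tsum_congr h, tsum_zero]
    exact zero_le
  | succ k ih =>
    intro G hG ε hε
    have hε2 : ε / 2 ≠ 0 := ENNReal.div_ne_zero.2 ⟨hε, by simp⟩
    let g : IsoClass C → ℝ≥0∞ := L.1.indicator fun x => absMu G x * m x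
    have hg : ∑' x, g x ≠ ∞ := by
      have h := hm.tsum_ne_top G hG
      rwa [tsum_subtype L.1 fun x => (absMu G x : ℝ≥0∞) * m x] at h
    -- `T₀` leaves a tail of the Möbius sum below `ε / 2`. The set `D` of classes one simple step
    -- outside `T` will lie in this tail.
    obtain ⟨T₀, hT₀, hGT₀⟩ := (((ENNReal.tendsto_tsum_compl_atTop_zero hg).eventually
      (gt_mem_nhds (pos_iff_ne_zero.2 hε2))).and (eventually_ge_atTop {G})).exists
    let T : Finset (IsoClass C) := T₀.filter fun x => x ∈ L.1
    have hGT : G ∈ T := Finset.mem_filter.2 ⟨hGT₀ (Finset.mem_singleton_self G), hG⟩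
    have hTL : ∀ x ∈ T, x ∈ L.1 := fun x hx => (Finset.mem_filter.1 hx).2
    have hDfin : (⋃ c ∈ T, {d | d ∈ L.1 ∧ ∃ (G : C) (a b : QuotObj G), a ⋖ b ∧ quotCls a = c ∧
        quotCls b = d}).Finite :=
      Set.Finite.biUnion T.finite_toSet fun c hc => L.finite_simple c (hTL c hc)
    let D : Finset (IsoClass C) := hDfin.toFinset.filter fun x => x ∉ T
    have hDL : ∀ x ∈ D, x ∈ L.1 ∧ x ∉ T := by
      intro x hx
      simp only [D, Finset.mem_filter, Set.Finite.mem_toFinset, Set.mem_iUnion] at hx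
      obtain ⟨⟨c, _, h⟩, hxT⟩ := hx
      exact ⟨h.1, hxT⟩
    have hD : ∀ H ∈ L.1, ∀ a b : QuotObj (IsoClass.rep H), a ⋖ b → quotCls a ∈ T →
        quotCls b ∉ T → quotCls b ∈ D := by
      intro H hH a b hab ha hb
      simp only [D, Finset.mem_filter, Set.Finite.mem_toFinset, Set.mem_iUnion]
      exact ⟨⟨quotCls a, ha, L.isFormation.downward _ _ (by rwa [cls_rep]), _, a, b, hab, rfl,
        rfl⟩, hb⟩
    have hDsum : ∑ x ∈ D, (absMu G x : ℝ≥0∞) * m x < ε / 2 := by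
      refine lt_of_le_of_lt ?_ hT₀
      have h₁ : ∑ x ∈ D, (absMu G x : ℝ≥0∞) * m x = ∑ x ∈ D, g x :=
        Finset.sum_congr rfl fun x hx => by simp only [g, Set.indicator_of_mem (hDL x hx).1]
      rw [h₁, ← Finset.tsum_subtype]
      refine ENNReal.tsum_mono_subtype (s := {x | x ∈ D}) (t := {x | x ∉ T₀}) g fun x hx hxT => ?_
      exact (hDL x hx).2 (Finset.mem_filter.2 ⟨hxT, (hDL x hx).1⟩)
    let Q : ℝ≥0∞ := ∑ x ∈ T, (quotCount x G : ℝ≥0∞)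
    have hQ : Q ≠ ∞ := by simp [Q]
    -- The induction hypothesis is used once for each `x ∈ T`, with multiplicity `quotCount x G`;
    -- the summand 1 avoids division by zero.
    let δ : ℝ≥0∞ := ε / 2 / (Q + 1)
    have hδ : δ ≠ 0 := ENNReal.div_ne_zero.2 ⟨hε2, by simp [hQ]⟩
    have hQδ : Q * δ ≤ ε / 2 :=
      calc Q * δ ≤ (Q + 1) * δ := by gcongr; exact le_self_add
        _ = ε / 2 := ENNReal.mul_div_cancel (by simp) (by simp [hQ])
    choose! A hA using fun (x : IsoClass C) (hx : x ∈ L.1) => ih x hx δ hδ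
    refine ⟨T.biUnion A, ?_⟩
    have hA' : ∀ᶠ i in l, ∀ x ∈ T,
        ∑' H, (if H ∈ A x then 0 else p i H * loewyCount k H x) ≤ δ :=
      (Finset.eventually_all T).2 fun x hx => hA x (hTL x hx)
    have hB' : ∀ᶠ i in l, ∑ x ∈ D, (absMu G x : ℝ≥0∞) * ∑' H, p i H * quotCount H x < ε / 2 := by
      refine Tendsto.eventually_lt_const hDsum (tendsto_finsetSum _ fun x hx => ?_)
      exact ENNReal.Tendsto.const_mul (hlim x (hDL x hx).1) (.inr (ENNReal.natCast_ne_top _))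
    filter_upwards [hA', hB'] with i hAi hBi
    have key : ∀ H, (if H ∈ T.biUnion A then 0 else p i H * loewyCount (k + 1) H G)
        ≤ ∑ x ∈ T, (quotCount x G : ℝ≥0∞) * (if H ∈ A x then 0 else p i H * loewyCount k H x)
          + ∑ x ∈ D, (absMu G x : ℝ≥0∞) * (p i H * quotCount H x) := by
      intro H
      by_cases hHL : H ∈ L.1
      swap
      · simp [hsupp i H hHL]
      split_ifs with hH
      · exact zero_le
      have h₁ : ∀ x ∈ T, H ∉ A x := fun x hx hHx => hH (Finset.mem_biUnion.2 ⟨x, hx, hHx⟩)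
      have h₂ : (loewyCount (k + 1) H G : ℝ≥0∞) ≤
          ∑ x ∈ T, (quotCount x G : ℝ≥0∞) * loewyCount k H x
            + ∑ x ∈ D, (absMu G x : ℝ≥0∞) * quotCount H x := by
        exact_mod_cast loewyCount_succ_le k H G T D hGT (hD H hHL)
      refine (mul_le_mul_right h₂ (p i H)).trans (le_of_eq ?_)
      rw [mul_add, Finset.mul_sum, Finset.mul_sum]
      congr 1
      · refine Finset.sum_congr rfl fun x hx => ?_
        rw [if_neg (h₁ x hx), mul_left_comm]
      · exact Finset.sum_congr rfl fun x hx => mul_left_comm _ _ _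
    refine (ENNReal.tsum_le_tsum key).trans ?_
    rw [ENNReal.tsum_add, Summable.tsum_finsetSum (fun _ _ => ENNReal.summable),
      Summable.tsum_finsetSum (fun _ _ => ENNReal.summable)]
    simp only [ENNReal.tsum_mul_left]
    rw [← ENNReal.add_halves ε]
    refine add_le_add ?_ hBi.le
    refine le_trans (Finset.sum_le_sum fun x hx => mul_le_mul_right (hAi x hx) _) ?_
    rw [← Finset.sum_mul]
    exact hQδ

open Classical in
/-- No mass, weighted by the number of quotients of class `G`, escapes to infinity. -/
theorem exists_finset_quotCount_le (L : Level C) {ι : Type*} {l : Filter ι}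
    {p : ι → IsoClass C → ℝ≥0∞} {m : IsoClass C → ℝ≥0∞} (hsupp : ∀ i H, H ∉ L.1 → p i H = 0)
    (hlim : ∀ G ∈ L.1, Tendsto (fun i => ∑' H, p i H * quotCount H G) l (𝓝 (m G)))
    (hm : IsMoebiusSummable L.1 m) {G : IsoClass C} (hG : G ∈ L.1) {ε : ℝ≥0∞} (hε : ε ≠ 0) :
    ∃ A : Finset (IsoClass C), ∀ᶠ i in l,
      ∑' H, (if H ∈ A then 0 else p i H * quotCount H G) ≤ ε := by
  obtain ⟨k, hk⟩ := L.exists_hasLoewyChain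
  obtain ⟨A, hA⟩ := exists_finset_loewyCount_le L hsupp hlim hm k G hG ε hε
  refine ⟨A, hA.mono fun i hi => le_trans (ENNReal.tsum_le_tsum fun H => ?_) hi⟩
  by_cases hH : H ∈ L.1
  · have : quotCount H G = loewyCount k H G := by
      rw [quotCount_eq_card, loewyCount]
      simp [hk H hH]
    rw [this]
  · simp [hsupp i H hH]

/-- Limits of weight functions along ultrafilters have the limit moments. -/
theorem hasNormalizedMoments_of_ultrafilter (L : Level C) {ι : Type*} {l : Filter ι}
    {p : ι → IsoClass C → ℝ≥0∞} {m : IsoClass C → ℝ≥0∞} (hsupp : ∀ i H, H ∉ L.1 → p i H = 0)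
    (hlim : ∀ G ∈ L.1, Tendsto (fun i => ∑' H, p i H * quotCount H G) l (𝓝 (m G)))
    (hm : IsMoebiusSummable L.1 m) (U : Ultrafilter ι) (hU : (U : Filter ι) ≤ l)
    {w : IsoClass C → ℝ≥0∞} (hw : ∀ H, Tendsto (fun i => p i H) U (𝓝 (w H))) :
    HasNormalizedMoments L.1 w m where
  support H hH := by
    have h := hw H
    simp only [hsupp _ H hH] at h
    exact tendsto_nhds_unique h tendsto_const_nhds
  tsum_eq G hG := by
    classical
    have hfin : ∀ A : Finset (IsoClass C), Tendsto (fun i => ∑ H ∈ A, p i H * quotCount H G) U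
        (𝓝 (∑ H ∈ A, w H * quotCount H G)) := fun A => tendsto_finsetSum _ fun H _ =>
      ENNReal.Tendsto.mul_const (hw H) (.inr (ENNReal.natCast_ne_top _))
    have hlim' := (hlim G hG).mono_left hU
    -- The bound from above is Fatou's lemma through finite partial sums; the bound from below needs
    -- that no mass escapes.
    refine le_antisymm ?_ ?_
    · rw [ENNReal.tsum_eq_iSup_sum]
      refine iSup_le fun A => ?_
      exact le_of_tendsto_of_tendsto' (hfin A) hlim' fun i => ENNReal.sum_le_tsum A
    · refine ENNReal.le_of_forall_pos_le_add fun ε hε _ => ?_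
      obtain ⟨A, hA⟩ := exists_finset_quotCount_le L hsupp hlim hm hG
        (ε := ε) (by simpa using hε.ne')
      refine le_trans ?_ (add_le_add_left (ENNReal.sum_le_tsum A) _)
      refine le_of_tendsto_of_tendsto hlim' ((hfin A).add_const (ε : ℝ≥0∞)) ?_
      filter_upwards [hA.filter_mono hU] with i hi
      have h : ∀ H, p i H * quotCount H G = (if H ∈ A then p i H * quotCount H G else 0)
          + (if H ∈ A then 0 else p i H * quotCount H G) := by
        intro H
        split_ifs <;> simp
      rw [tsum_congr h, ENNReal.tsum_add]
      refine add_le_add ?_ hi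
      rw [tsum_eq_sum (s := A) (by intro H hH; simp [hH])]
      exact le_of_eq (Finset.sum_congr rfl fun H hH => by simp [hH])

/-- If the moments converge to well-behaved numbers, then the weight functions converge. -/
theorem exists_hasNormalizedMoments_tendsto (L : Level C) {ι : Type*} {l : Filter ι} [l.NeBot]
    {p : ι → IsoClass C → ℝ≥0∞} {m : IsoClass C → ℝ≥0∞} (hsupp : ∀ i H, H ∉ L.1 → p i H = 0)
    (hlim : ∀ G ∈ L.1, Tendsto (fun i => ∑' H, p i H * quotCount H G) l (𝓝 (m G)))
    (hm : IsMoebiusSummable L.1 m) :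
    ∃ w, HasNormalizedMoments L.1 w m ∧ ∀ H, Tendsto (fun i => p i H) l (𝓝 (w H)) := by
  have hex : ∀ U : Ultrafilter ι, ∃ w : IsoClass C → ℝ≥0∞,
      ∀ H, Tendsto (fun i => p i H) U (𝓝 (w H)) := by
    intro U
    have h : ∀ H, ∃ x : ℝ≥0∞, Tendsto (fun i => p i H) U (𝓝 x) := by
      intro H
      obtain ⟨x, -, hx⟩ := isCompact_univ.ultrafilter_le_nhds (U.map fun i => p i H) (by simp)
      exact ⟨x, hx⟩
    choose w hw using h
    exact ⟨w, hw⟩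
  obtain ⟨w, hw⟩ := hex (Ultrafilter.of l)
  have hwm := hasNormalizedMoments_of_ultrafilter L hsupp hlim hm _ (Ultrafilter.of_le l) hw
  refine ⟨w, hwm, fun H => ?_⟩
  -- Every ultrafilter limit has the moments `m`, so by uniqueness all of them equal `w`.
  rw [tendsto_iff_ultrafilter]
  intro U hU
  obtain ⟨w', hw'⟩ := hex U
  have hwm' := hasNormalizedMoments_of_ultrafilter L hsupp hlim hm U hU hw'
  rw [hwm.unique L.isFormation hwm' hm]
  exact hw' H

end Moments

/-! ### Cylinders, measurability and a cofinal chain of levels -/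

section ProIsoSpace

variable {C : Type u} [Category.{v} C]

theorem Level.exists_ge (K K' : Level C) : ∃ L : Level C, K.1 ⊆ L.1 ∧ K'.1 ⊆ L.1 := by
  classical
  obtain ⟨B, rfl⟩ := K.exists_finset
  obtain ⟨B', rfl⟩ := K'.exists_finset
  refine ⟨levelOf (B ∪ B'), (levelOf_subset_iff _).2 ?_, (levelOf_subset_iff _).2 ?_⟩
  · exact fun c hc => mem_levelOf (Finset.mem_union_left _ hc)
  · exact fun c hc => mem_levelOf (Finset.mem_union_right _ hc)

theorem levelOf_empty_subset (K : Level C) : (levelOf ∅ : Level C).1 ⊆ K.1 :=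
  (levelOf_subset_iff _).2 (by simp)

instance [Countable (IsoClass C)] : Countable (Level C) :=
  (show Function.Surjective (levelOf (C := C)) from fun L =>
    let ⟨B, hB⟩ := L.exists_finset; ⟨B, hB.symm⟩).countable

/-- The pro-isomorphism classes with `K`-quotient in `s`. -/
def cylinder (K : Level C) (s : Set (IsoClass C)) : Set (ProIso C) := {X | X.val K ∈ s}

theorem cylinder_eq_iUnion (K : Level C) (s : Set (IsoClass C)) :
    cylinder K s = ⋃ F : s, basicOpen K F := by
  ext X
  simp [cylinder, basicOpen]

theorem basicOpen_eq_empty {K : Level C} {F : IsoClass C} (hF : F ∉ K.1) : basicOpen K F = ∅ :=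
  Set.eq_empty_of_forall_notMem fun X hX => hF (hX ▸ X.mem K)

theorem measurableSet_basicOpen (K : Level C) (F : IsoClass C) :
    MeasurableSet (basicOpen K F) := by
  by_cases hF : F ∈ K.1
  · exact MeasurableSpace.measurableSet_generateFrom ⟨K, F, hF, rfl⟩
  · rw [basicOpen_eq_empty hF]
    exact MeasurableSet.empty

theorem disjoint_basicOpen (K : Level C) {F F' : IsoClass C} (h : F ≠ F') :
    Disjoint (basicOpen K F) (basicOpen K F') :=
  Set.disjoint_left.2 fun _ hX hX' => h (hX.symm.trans hX')

variable [Countable (IsoClass C)]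

theorem measurableSet_cylinder (K : Level C) (s : Set (IsoClass C)) :
    MeasurableSet (cylinder K s) := by
  rw [cylinder_eq_iUnion]
  exact MeasurableSet.iUnion fun F => measurableSet_basicOpen K F

theorem measure_cylinder (ρ : Measure (ProIso C)) (K : Level C) (s : Set (IsoClass C)) :
    ρ (cylinder K s) = ∑' F : s, ρ (basicOpen K F) := by
  rw [cylinder_eq_iUnion, measure_iUnion]
  · exact fun F F' h => disjoint_basicOpen K fun h' => h (Subtype.ext h')
  · exact fun F => measurableSet_basicOpen K F

theorem lintegral_comp_val (ρ : Measure (ProIso C)) (K : Level C) (f : IsoClass C → ℝ≥0∞) :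
    ∫⁻ X, f (X.val K) ∂ρ = ∑' F, f F * ρ (basicOpen K F) := by
  let _ : MeasurableSpace (IsoClass C) := ⊤
  have hmeas : Measurable fun X : ProIso C => X.val K := fun s _ => measurableSet_cylinder K s
  have hf : Measurable f := fun _ _ => trivial
  have : MeasurableSingletonClass (IsoClass C) := ⟨fun _ => trivial⟩
  rw [← lintegral_map hf hmeas, lintegral_countable']
  refine tsum_congr fun F => ?_
  rw [Measure.map_apply hmeas (measurableSet_singleton F)]
  rfl

theorem generateFrom_cylinder : (inferInstance : MeasurableSpace (ProIso C))
    = MeasurableSpace.generateFrom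
      {A : Set (ProIso C) | ∃ (K : Level C) (s : Set (IsoClass C)), A = cylinder K s} := by
  refine le_antisymm (MeasurableSpace.generateFrom_mono ?_) (MeasurableSpace.generateFrom_le ?_)
  · rintro _ ⟨K, F, -, rfl⟩
    exact ⟨K, {F}, rfl⟩
  · rintro _ ⟨K, s, rfl⟩
    exact measurableSet_cylinder K s

theorem exists_level_chain : ∃ L : ℕ → Level C, (∀ m n, m ≤ n → (L m).1 ⊆ (L n).1) ∧
    ∀ K : Level C, ∃ n, K.1 ⊆ (L n).1 := by
  classical
  obtain ⟨f, hf⟩ := Countable.exists_injective_nat (IsoClass C)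
  have hfin : ∀ n, {c | f c < n}.Finite := fun n =>
    (Set.finite_Iio n).preimage (hf.injOn)
  refine ⟨fun n => levelOf (hfin n).toFinset, fun m n hmn => ?_, fun K => ?_⟩
  · refine (levelOf_subset_iff _).2 fun c hc => mem_levelOf ?_
    simp only [Set.Finite.coe_toFinset, Set.mem_ofPred_eq, Set.Finite.mem_toFinset] at hc ⊢
    omega
  · obtain ⟨B, rfl⟩ := K.exists_finset
    obtain ⟨n, hn⟩ := (B.finite_toSet.image f).bddAbove
    refine ⟨n + 1, (levelOf_subset_iff _).2 fun c hc => mem_levelOf ?_⟩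
    simpa using Nat.lt_succ_of_le (hn ⟨c, hc, rfl⟩)

end ProIsoSpace

/-! ### Compatible sequences along a chain of levels and the pro-isomorphism classes they define -/

section Diamond

variable {C : Type u} [Category.{v} C] [DiamondCategory C]

theorem ProIso.val_eq (X : ProIso C) {K K' : Level C} (h : K.1 ⊆ K'.1) :
    X.val K = maxQuot K.1 (X.val K') :=
  K.isFormation.isMaximalQuotient_iff.1 (X.compat K K' h)

theorem cylinder_eq_cylinder {K K' : Level C} (h : K.1 ⊆ K'.1) (s : Set (IsoClass C)) :
    cylinder K s = cylinder K' (maxQuot K.1 ⁻¹' s) := by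
  ext X
  simp [cylinder, X.val_eq h]

theorem isPiSystem_cylinder :
    IsPiSystem {A : Set (ProIso C) | ∃ (K : Level C) (s : Set (IsoClass C)), A = cylinder K s} := by
  rintro _ ⟨K, s, rfl⟩ _ ⟨K', s', rfl⟩ -
  obtain ⟨L, h, h'⟩ := K.exists_ge K'
  refine ⟨L, maxQuot K.1 ⁻¹' s ∩ maxQuot K'.1 ⁻¹' s', ?_⟩
  rw [cylinder_eq_cylinder h, cylinder_eq_cylinder h']
  rfl

/-- Weights on the levels, compatible with taking maximal quotients. -/
structure IsConsistent (w : Level C → IsoClass C → ℝ≥0∞) : Prop where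
  support : ∀ K, ∀ F ∉ K.1, w K F = 0
  ne_top : ∀ K F, w K F ≠ ∞
  tsum_eq : ∀ K K' : Level C, K.1 ⊆ K'.1 → ∀ F,
    ∑' F' : maxQuot K.1 ⁻¹' {F}, w K' F' = w K F

theorem IsConsistent.le {w : Level C → IsoClass C → ℝ≥0∞} (hw : IsConsistent w) {K K' : Level C}
    (h : K.1 ⊆ K'.1) (F : IsoClass C) : w K' F ≤ w K (maxQuot K.1 F) := by
  rw [← hw.tsum_eq K K' h]
  exact ENNReal.le_tsum (f := fun F' : maxQuot K.1 ⁻¹' {maxQuot K.1 F} => w K' F') ⟨F, rfl⟩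

section Chain

variable (L : ℕ → Level C)

open Classical in
/-- The path starting at `c` that follows the choices `ω`, where a choice that is not an extension
is ignored. -/
def path (c : IsoClass C) (ω : ℕ × IsoClass C → IsoClass C) : ℕ → IsoClass C
  | 0 => c
  | n + 1 =>
    if ω (n, path c ω n) ∈ (L (n + 1)).1 ∧ maxQuot (L n).1 (ω (n, path c ω n)) = path c ω n then
      ω (n, path c ω n) else path c ω n

variable {L}

theorem path_mem (hL : ∀ m n, m ≤ n → (L m).1 ⊆ (L n).1)
    {c : IsoClass C} (hc : c ∈ (L 0).1) (ω : ℕ × IsoClass C → IsoClass C) (n : ℕ) :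
    path L c ω n ∈ (L n).1 := by
  induction n with
  | zero => exact hc
  | succ n ih =>
    rw [path]
    split_ifs with h
    · exact h.1
    · exact hL _ _ n.le_succ ih

theorem maxQuot_path_succ (hL : ∀ m n, m ≤ n → (L m).1 ⊆ (L n).1)
    {c : IsoClass C} (hc : c ∈ (L 0).1) (ω : ℕ × IsoClass C → IsoClass C)
    (n : ℕ) : maxQuot (L n).1 (path L c ω (n + 1)) = path L c ω n := by
  rw [path]
  split_ifs with h
  · exact h.2
  · exact (L n).isFormation.maxQuot_of_mem (path_mem hL hc ω n)

theorem maxQuot_path (hL : ∀ m n, m ≤ n → (L m).1 ⊆ (L n).1)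
    {c : IsoClass C} (hc : c ∈ (L 0).1) (ω : ℕ × IsoClass C → IsoClass C)
    {m n : ℕ} (hmn : m ≤ n) : maxQuot (L m).1 (path L c ω n) = path L c ω m := by
  induction n, hmn using Nat.le_induction with
  | base => exact (L m).isFormation.maxQuot_of_mem (path_mem hL hc ω m)
  | succ n hmn ih =>
    rw [← (L m).isFormation.maxQuot_maxQuot (L n).isFormation (hL m n hmn),
      maxQuot_path_succ hL hc, ih]

theorem maxQuot_path_eq (hL : ∀ m n, m ≤ n → (L m).1 ⊆ (L n).1)
    {c : IsoClass C} (hc : c ∈ (L 0).1) (ω : ℕ × IsoClass C → IsoClass C)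
    (K : Level C) {m n : ℕ} (hm : K.1 ⊆ (L m).1) (hn : K.1 ⊆ (L n).1) :
    maxQuot K.1 (path L c ω m) = maxQuot K.1 (path L c ω n) := by
  wlog hmn : m ≤ n generalizing m n
  · exact (this hn hm (le_of_not_ge hmn)).symm
  rw [← maxQuot_path hL hc ω hmn, K.isFormation.maxQuot_maxQuot (L m).isFormation hm]

/-- The pro-isomorphism class given by a path. -/
def pathProIso (hL : ∀ m n, m ≤ n → (L m).1 ⊆ (L n).1)
    (hcof : ∀ K : Level C, ∃ n, K.1 ⊆ (L n).1) {c : IsoClass C} (hc : c ∈ (L 0).1)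
    (ω : ℕ × IsoClass C → IsoClass C) : ProIso C where
  val K := maxQuot K.1 (path L c ω (hcof K).choose)
  mem K := K.isFormation.maxQuot_mem _
  compat K K' h := by
    rw [K.isFormation.isMaximalQuotient_iff, K.isFormation.maxQuot_maxQuot K'.isFormation h]
    exact maxQuot_path_eq hL hc ω K (hcof K).choose_spec (h.trans (hcof K').choose_spec)

theorem pathProIso_val (hL : ∀ m n, m ≤ n → (L m).1 ⊆ (L n).1)
    (hcof : ∀ K : Level C, ∃ n, K.1 ⊆ (L n).1) {c : IsoClass C}
    (hc : c ∈ (L 0).1) (ω : ℕ × IsoClass C → IsoClass C) (n : ℕ) :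
    (pathProIso hL hcof hc ω).val (L n) = path L c ω n := by
  change maxQuot (L n).1 (path L c ω _) = _
  rw [maxQuot_path_eq hL hc ω (L n) (hcof (L n)).choose_spec (subset_refl (L n).1),
    (L n).isFormation.maxQuot_of_mem (path_mem hL hc ω n)]

end Chain

variable [Countable (IsoClass C)]

/-- A measure that is finite on the basic open sets is determined by its values on them. -/
theorem measure_ext_of_basicOpen {ρ ρ' : Measure (ProIso C)}
    (h : ∀ K F, ρ (basicOpen K F) = ρ' (basicOpen K F)) (hfin : ∀ K F, ρ (basicOpen K F) ≠ ∞) :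
    ρ = ρ' := by
  refine Measure.ext_of_generateFrom_of_cover_subset generateFrom_cylinder isPiSystem_cylinder
    (T := Set.range fun F : IsoClass C => basicOpen (levelOf ∅) F) ?_ (Set.countable_range _) ?_ ?_
    ?_
  · rintro _ ⟨F, rfl⟩
    exact ⟨_, {F}, rfl⟩
  · exact Set.eq_univ_of_forall fun X => ⟨_, ⟨X.val (levelOf ∅), rfl⟩, rfl⟩
  · rintro _ ⟨F, rfl⟩
    exact hfin _ F
  · rintro _ ⟨K, s, rfl⟩
    rw [measure_cylinder, measure_cylinder]
    exact tsum_congr fun F => h K F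


end Diamond

/-! ### Kolmogorov extension of consistent weights -/

section Existence

variable {C : Type u} [Category.{v} C] [DiamondCategory C]

open Classical in
/-- The conditional distribution of the `K'`-quotient given that the `K`-quotient is `c`. -/
def condDist [MeasurableSpace (IsoClass C)] (w : Level C → IsoClass C → ℝ≥0∞) (K K' : Level C)
    (c : IsoClass C) : Measure (IsoClass C) :=
  if w K c = 0 then Measure.dirac c else
    (w K c)⁻¹ • Measure.sum fun d : maxQuot K.1 ⁻¹' {c} => w K' d • Measure.dirac d.1

variable {w : Level C → IsoClass C → ℝ≥0∞}

theorem IsConsistent.isProbabilityMeasure_condDist [MeasurableSpace (IsoClass C)]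
    (hw : IsConsistent w) {K K' : Level C} (h : K.1 ⊆ K'.1) (c : IsoClass C) :
    IsProbabilityMeasure (condDist w K K' c) := by
  unfold condDist
  split_ifs with h0
  · infer_instance
  · constructor
    rw [Measure.smul_apply, Measure.sum_apply _ MeasurableSet.univ]
    simp only [Measure.smul_apply, measure_univ, smul_eq_mul, mul_one]
    rw [hw.tsum_eq K K' h, ENNReal.inv_mul_cancel h0 (hw.ne_top K c)]

theorem IsConsistent.le_condDist [MeasurableSpace (IsoClass C)]
    [MeasurableSingletonClass (IsoClass C)] (hw : IsConsistent w) {K K' : Level C}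
    (d : IsoClass C) (h0 : w K (maxQuot K.1 d) ≠ 0) :
    w K' d ≤ w K (maxQuot K.1 d) * condDist w K K' (maxQuot K.1 d) {d} := by
  rw [condDist, if_neg h0, Measure.smul_apply, smul_eq_mul, ← mul_assoc,
    ENNReal.mul_inv_cancel h0 (hw.ne_top _ _), one_mul,
    Measure.sum_apply _ (measurableSet_singleton d)]
  refine le_trans ?_ (ENNReal.le_tsum (⟨d, rfl⟩ : maxQuot K.1 ⁻¹' {maxQuot K.1 d}))
  simp

/-- Reaching `d` is forced by finitely many prescribed coordinates of `ω`, an event whose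
probability under a product measure is a product. -/
theorem path_eq_of_forall {L : ℕ → Level C} (hL : ∀ m n, m ≤ n → (L m).1 ⊆ (L n).1)
    {ω : ℕ × IsoClass C → IsoClass C} {d : IsoClass C} {n : ℕ}
    (h : ∀ i < n, ω (i, maxQuot (L i).1 d) = maxQuot (L (i + 1)).1 d) :
    path L (maxQuot (L 0).1 d) ω n = maxQuot (L n).1 d := by
  induction n with
  | zero => rfl
  | succ n ih =>
    have ih' := ih fun i hi => h i (hi.trans n.lt_succ_self)
    rw [path, ih', h n n.lt_succ_self, if_pos]
    exact ⟨(L (n + 1)).isFormation.maxQuot_mem _,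
      (L n).isFormation.maxQuot_maxQuot (L (n + 1)).isFormation (hL _ _ n.le_succ) d⟩

variable [Countable (IsoClass C)]

theorem measurable_path [MeasurableSpace (IsoClass C)] [DiscreteMeasurableSpace (IsoClass C)]
    (L : ℕ → Level C) (c : IsoClass C) (n : ℕ) : Measurable fun ω => path L c ω n := by
  classical
  induction n with
  | zero => exact measurable_const
  | succ n ih =>
    have h₁ : Measurable fun q : IsoClass C × (ℕ × IsoClass C → IsoClass C) => q.2 (n, q.1) :=
      measurable_from_prod_countable_right fun d =>
        measurable_pi_apply (n, d)
    have h₂ : Measurable fun q : IsoClass C × IsoClass C =>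
        if q.2 ∈ (L (n + 1)).1 ∧ maxQuot (L n).1 q.2 = q.1 then q.2 else q.1 :=
      Measurable.of_discrete
    exact h₂.comp (ih.prodMk (h₁.comp (ih.prodMk measurable_id)))

/-- A measure on paths from `c` with the prescribed weights as lower bounds. -/
theorem IsConsistent.exists_measure_ge (hw : IsConsistent w) {L : ℕ → Level C}
    (hL : ∀ m n, m ≤ n → (L m).1 ⊆ (L n).1) (hcof : ∀ K : Level C, ∃ n, K.1 ⊆ (L n).1)
    {c : IsoClass C} (hc : c ∈ (L 0).1) :
    ∃ ρ : Measure (ProIso C), ρ (basicOpen (L 0) c)ᶜ = 0 ∧ ρ (basicOpen (L 0) c) ≤ w (L 0) c ∧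
      ∀ n, ∀ d ∈ (L n).1, maxQuot (L 0).1 d = c → w (L n) d ≤ ρ (basicOpen (L n) d) := by
  classical
  let _ : MeasurableSpace (IsoClass C) := ⊤
  have : DiscreteMeasurableSpace (IsoClass C) := ⟨fun _ => trivial⟩
  -- One independent choice for each pair of a time and a current class: this realizes the Markov
  -- chain of conditional distributions by a plain product measure.
  let κ : ℕ × IsoClass C → Measure (IsoClass C) := fun i => condDist w (L i.1) (L (i.1 + 1)) i.2
  have hκ : ∀ i, IsProbabilityMeasure (κ i) := fun i =>
    hw.isProbabilityMeasure_condDist (hL _ _ i.1.le_succ) i.2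
  let P := Measure.infinitePi κ
  let Φ := pathProIso hL hcof hc
  have hval : ∀ ω n, (Φ ω).val (L n) = path L c ω n := fun ω n => pathProIso_val hL hcof hc ω n
  have hΦ : Measurable Φ := by
    refine measurable_generateFrom ?_
    rintro _ ⟨K, F, -, rfl⟩
    exact ((Measurable.of_discrete (f := maxQuot K.1)).comp (measurable_path L c _))
      (measurableSet_singleton F)
  refine ⟨w (L 0) c • P.map Φ, ?_, ?_, ?_⟩
  · rw [Measure.smul_apply, Measure.map_apply hΦ (measurableSet_basicOpen _ _).compl]
    have : Φ ⁻¹' (basicOpen (L 0) c)ᶜ = ∅ :=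
      Set.eq_empty_of_forall_notMem fun ω hω => hω (hval ω 0)
    simp [this]
  · rw [Measure.smul_apply, Measure.map_apply hΦ (measurableSet_basicOpen _ _), smul_eq_mul]
    exact mul_le_of_le_one_right zero_le prob_le_one
  · rintro n d hd rfl
    by_cases h0 : w (L n) d = 0
    · simp [h0]
    have hdn : maxQuot (L n).1 d = d := (L n).isFormation.maxQuot_of_mem hd
    have hi0 : ∀ i ≤ n, w (L i) (maxQuot (L i).1 d) ≠ 0 := fun i hi h =>
      h0 (le_antisymm (h ▸ hw.le (hL i n hi) d) zero_le)
    let D : ℕ → IsoClass C := fun i => maxQuot (L i).1 d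
    have hD : ∀ i, maxQuot (L i).1 (D (i + 1)) = D i := fun i =>
      (L i).isFormation.maxQuot_maxQuot (L (i + 1)).isFormation (hL _ _ i.le_succ) d
    have hprod : ∀ k ≤ n, w (L k) (D k) ≤ w (L 0) (D 0) *
        ∏ i ∈ Finset.range k, κ (i, D i) {D (i + 1)} := by
      intro k hk
      induction k with
      | zero => simp
      | succ k ih =>
        rw [Finset.prod_range_succ, ← mul_assoc]
        have h := hw.le_condDist (K' := L (k + 1)) (D (k + 1))
          (by rw [hD]; exact hi0 k (by omega))
        rw [hD] at h
        exact h.trans (mul_le_mul_left (ih (by omega)) _)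
    -- The coordinates consulted on the way to `d`, distinct because their times differ.
    let s : Finset (ℕ × IsoClass C) := (Finset.range n).image fun i => (i, D i)
    have hs : P (Set.pi s fun i => {D (i.1 + 1)})
        = ∏ i ∈ Finset.range n, κ (i, D i) {D (i + 1)} := by
      rw [Measure.infinitePi_pi κ fun i _ => measurableSet_singleton _, Finset.prod_image]
      intro i _ j _ h
      exact congrArg Prod.fst h
    have h₁ := hprod n le_rfl
    rw [← hs] at h₁
    simp only [D, hdn] at h₁
    refine h₁.trans ?_
    rw [Measure.smul_apply, Measure.map_apply hΦ (measurableSet_basicOpen _ _), smul_eq_mul]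
    refine mul_le_mul_right (measure_mono fun ω hω => ?_) _
    change (Φ ω).val (L n) = d
    rw [hval, ← hdn]
    nth_rewrite 1 [hdn]
    refine path_eq_of_forall hL fun i hi => ?_
    exact hω (i, D i) (Finset.mem_coe.2 (Finset.mem_image_of_mem _ (Finset.mem_range.2 hi)))

/-- Kolmogorov extension: consistent weights come from a measure. -/
theorem IsConsistent.exists_measure (hw : IsConsistent w) :
    ∃ ρ : Measure (ProIso C), ∀ K F, ρ (basicOpen K F) = w K F := by
  obtain ⟨L, hL, hcof⟩ := exists_level_chain (C := C)
  choose! ρ hρ₁ hρ₂ hρ₃ using fun (c : IsoClass C) (hc : c ∈ (L 0).1) =>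
    hw.exists_measure_ge hL hcof hc
  let ν : Measure (ProIso C) := Measure.sum fun c : (L 0).1 => ρ c
  have hν : ∀ K F, ν (basicOpen K F) = ∑' c : (L 0).1, ρ c (basicOpen K F) := fun K F =>
    Measure.sum_apply _ (measurableSet_basicOpen K F)
  have hge : ∀ n d, w (L n) d ≤ ν (basicOpen (L n) d) := by
    intro n d
    by_cases hd : d ∈ (L n).1
    · have hc := (L 0).isFormation.maxQuot_mem d
      rw [hν]
      exact (hρ₃ _ hc n d hd rfl).trans (ENNReal.le_tsum
        (f := fun c : (L 0).1 => ρ c (basicOpen (L n) d)) ⟨_, hc⟩)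
    · simp [hw.support _ d hd]
  have hle : ∀ c, ν (basicOpen (L 0) c) ≤ w (L 0) c := by
    intro c
    by_cases hc : c ∈ (L 0).1
    · rw [hν, tsum_eq_single (⟨c, hc⟩ : (L 0).1)]
      · exact hρ₂ c hc
      · intro d hd
        refine measure_mono_null ?_ (hρ₁ d d.2)
        exact Set.disjoint_left.1 (disjoint_basicOpen _ fun h => hd (Subtype.ext h.symm))
    · simp [basicOpen_eq_empty hc]
  have hsum : ∀ {K K' : Level C}, K.1 ⊆ K'.1 → ∀ F,
      ν (basicOpen K F) = ∑' F' : maxQuot K.1 ⁻¹' {F}, ν (basicOpen K' F') := by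
    intro K K' h F
    rw [← measure_cylinder, ← cylinder_eq_cylinder h]
    rfl
  have heq : ∀ n d, ν (basicOpen (L n) d) = w (L n) d := by
    intro n d
    -- The lower bounds suffice: strict inequality at one `d` would, summed over the fibre of `d`
    -- over `L 0`, exceed the finite upper bound `hle`.
    refine le_antisymm (le_of_not_gt fun hlt => ?_) (hge n d)
    have h₁ := ENNReal.tsum_lt_tsum (f := fun F' : maxQuot (L 0).1 ⁻¹' {maxQuot (L 0).1 d} =>
      w (L n) F') (g := fun F' => ν (basicOpen (L n) F')) (i := ⟨d, rfl⟩)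
      (by rw [hw.tsum_eq _ _ (hL 0 n n.zero_le)]; exact hw.ne_top _ _) (fun F' => hge n F') hlt
    rw [hw.tsum_eq _ _ (hL 0 n n.zero_le), ← hsum (hL 0 n n.zero_le)] at h₁
    exact h₁.not_ge (hle _)
  refine ⟨ν, fun K F => ?_⟩
  obtain ⟨n, hn⟩ := hcof K
  rw [hsum hn, ← hw.tsum_eq K (L n) hn]
  exact tsum_congr fun F' => heq n F'

end Existence

/-! ### Open sets as directed unions of cylinders, and a criterion for weak convergence -/

section WeakConvergence

variable {C : Type u} [Category.{v} C] [DiamondCategory C]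

theorem exists_basicOpen_subset {U : Set (ProIso C)} (hU : IsOpen U) {X : ProIso C} (hX : X ∈ U) :
    ∃ K : Level C, basicOpen K (X.val K) ⊆ U := by
  have hmono : ∀ {K K' : Level C}, K.1 ⊆ K'.1 →
      basicOpen K' (X.val K') ⊆ basicOpen K (X.val K) := by
    intro K K' h Y hY
    have hY' : Y.val K' = X.val K' := hY
    change Y.val K = X.val K
    rw [Y.val_eq h, X.val_eq h, hY']
  have hU' : TopologicalSpace.GenerateOpen (basicOpens C) U := hU
  induction hU' with
  | basic V hV =>
    obtain ⟨K, F, -, rfl⟩ := hV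
    exact ⟨K, fun Y hY => hY.trans hX⟩
  | univ => exact ⟨levelOf ∅, Set.subset_univ _⟩
  | inter V W hV hW ihV ihW =>
    obtain ⟨K, hK⟩ := ihV hV hX.1
    obtain ⟨K', hK'⟩ := ihW hW hX.2
    obtain ⟨L, h, h'⟩ := K.exists_ge K'
    exact ⟨L, fun Y hY => ⟨hK (hmono h hY), hK' (hmono h' hY)⟩⟩
  | sUnion S hS ih =>
    obtain ⟨V, hV, hXV⟩ := hX
    obtain ⟨K, hK⟩ := ih V hV (hS V hV) hXV
    exact ⟨K, hK.trans (Set.subset_sUnion_of_mem hV)⟩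

/-- An open set is the union over the levels of the cylinders it contains. -/
theorem iUnion_cylinder_eq {U : Set (ProIso C)} (hU : IsOpen U) :
    ⋃ K : Level C, cylinder K {F | basicOpen K F ⊆ U} = U := by
  ext X
  simp only [Set.mem_iUnion]
  constructor
  · rintro ⟨K, hK⟩
    exact hK rfl
  · exact exists_basicOpen_subset hU

theorem cylinder_subset_cylinder {K K' : Level C} (h : K.1 ⊆ K'.1) (U : Set (ProIso C)) :
    cylinder K {F | basicOpen K F ⊆ U} ⊆ cylinder K' {F | basicOpen K' F ⊆ U} := by
  intro X hX Y hY
  have hY' : Y.val K' = X.val K' := hY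
  refine hX (show Y.val K = X.val K from ?_)
  rw [Y.val_eq h, X.val_eq h, hY']

variable [Countable (IsoClass C)]

theorem measure_eq_iSup_cylinder (ρ : Measure (ProIso C)) {U : Set (ProIso C)} (hU : IsOpen U) :
    ρ U = ⨆ K : Level C, ρ (cylinder K {F | basicOpen K F ⊆ U}) := by
  rw [← Directed.measure_iUnion, iUnion_cylinder_eq hU]
  intro K K'
  obtain ⟨L, h, h'⟩ := K.exists_ge K'
  exact ⟨L, cylinder_subset_cylinder h U, cylinder_subset_cylinder h' U⟩

/-- The mass of `U` is a supremum over cylinders inside `U`, and each of these over finite unions of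
basic open sets, on which the measures converge. -/
theorem measure_le_liminf {ρ : ℕ → Measure (ProIso C)} {ρ' : Measure (ProIso C)}
    (h : ∀ K F, Tendsto (fun t => ρ t (basicOpen K F)) atTop (𝓝 (ρ' (basicOpen K F))))
    {U : Set (ProIso C)} (hU : IsOpen U) : ρ' U ≤ liminf (fun t => ρ t U) atTop := by
  rw [measure_eq_iSup_cylinder ρ' hU]
  refine iSup_le fun K => ?_
  rw [measure_cylinder, ENNReal.tsum_eq_iSup_sum]
  refine iSup_le fun A => ?_
  rw [← (tendsto_finsetSum A fun (F : {F | basicOpen K F ⊆ U}) _ => h K F).liminf_eq]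
  refine liminf_le_liminf (Eventually.of_forall fun t => ?_)
  refine (ENNReal.sum_le_tsum A).trans ?_
  rw [← measure_cylinder]
  exact measure_mono fun X hX => hX rfl

instance : OpensMeasurableSpace (ProIso C) where
  borel_le := by
    refine MeasurableSpace.generateFrom_le fun U hU => ?_
    rw [← iUnion_cylinder_eq hU]
    exact MeasurableSet.iUnion fun K => measurableSet_cylinder K _

/-- Convergence on the basic open sets and of the total masses implies weak convergence. -/
theorem weaklyConverges_of_tendsto {ρ : ℕ → Measure (ProIso C)} {ρ' : Measure (ProIso C)}
    (h : ∀ K F, Tendsto (fun t => ρ t (basicOpen K F)) atTop (𝓝 (ρ' (basicOpen K F))))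
    (huniv : Tendsto (fun t => ρ t Set.univ) atTop (𝓝 (ρ' Set.univ)))
    (hfin : ρ' Set.univ ≠ ∞) : WeaklyConverges ρ ρ' := by
  intro f
  have hfatou : ∀ g : ProIso C → ℝ≥0, Continuous g →
      ∫⁻ x, g x ∂ρ' ≤ liminf (fun t => ∫⁻ x, g x ∂ρ t) atTop := by
    intro g hg
    have h₁ := lintegral_le_liminf_lintegral_of_forall_isOpen_measure_le_liminf_measure
      (NNReal.continuous_coe.comp hg) (fun _ => NNReal.coe_nonneg _)
      (fun U hU => measure_le_liminf h hU)
    simpa using h₁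
  obtain ⟨c, hc⟩ : ∃ c : ℝ≥0, ∀ x, f x ≤ c := by
    refine ⟨nndist f 0, fun x => ?_⟩
    exact BoundedContinuousFunction.NNReal.upper_bound f x
  have hsum : ∀ τ : Measure (ProIso C),
      ∫⁻ x, f x ∂τ + ∫⁻ x, ((c - f x : ℝ≥0) : ℝ≥0∞) ∂τ = c * τ Set.univ := by
    intro τ
    rw [← lintegral_add_left f.continuous.measurable.coe_nnreal_ennreal, ← lintegral_const]
    refine lintegral_congr fun x => ?_
    rw [← ENNReal.coe_add, add_tsub_cancel_of_le (hc x)]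
  -- The lower bound `hfatou` is applied to `f` and to `c - f`. The sum of the two integrals
  -- converges to a finite limit, so neither inequality can be strict.
  have hcont : Continuous fun x => c - f x := continuous_const.sub f.continuous
  rw [tendsto_iff_ultrafilter]
  intro V hV
  have hlim : ∀ u : ℕ → ℝ≥0∞, ∃ a, Tendsto u V (𝓝 a) := fun u => by
    obtain ⟨x, -, hx⟩ := isCompact_univ.ultrafilter_le_nhds (V.map u) (by simp)
    exact ⟨x, hx⟩
  obtain ⟨a, ha⟩ := hlim fun t => ∫⁻ x, f x ∂ρ t
  obtain ⟨b, hb⟩ := hlim fun t => ∫⁻ x, ((c - f x : ℝ≥0) : ℝ≥0∞) ∂ρ t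
  have ha' : ∫⁻ x, f x ∂ρ' ≤ a :=
    (hfatou f f.continuous).trans ((liminf_le_liminf_of_le hV).trans_eq ha.liminf_eq)
  have hb' : ∫⁻ x, ((c - f x : ℝ≥0) : ℝ≥0∞) ∂ρ' ≤ b :=
    (hfatou _ hcont).trans ((liminf_le_liminf_of_le hV).trans_eq hb.liminf_eq)
  have hab : a + b = c * ρ' Set.univ := by
    refine tendsto_nhds_unique (ha.add hb) ?_
    simp only [hsum]
    exact ENNReal.Tendsto.const_mul (huniv.mono_left hV) (.inr ENNReal.coe_ne_top)
  have hne : a + b ≠ ∞ := hab ▸ ENNReal.mul_ne_top ENNReal.coe_ne_top hfin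
  rw [← hsum ρ'] at hab
  have hale : a ≤ ∫⁻ x, f x ∂ρ' := by
    refine ENNReal.le_of_add_le_add_right (ENNReal.add_ne_top.1 hne).2 ?_
    rw [hab]
    gcongr
  rwa [le_antisymm ha' hale]

end WeakConvergence

/-! ### From moments of measures to normalized weights, and restriction over minimal objects -/

section Main

variable {C : Type u} [Category.{v} C]

theorem ennreal_eq_ofReal {x : ℝ≥0∞} {r : ℝ} (h : (x : EReal) = (r : EReal)) :
    x = ENNReal.ofReal r := by
  have hr : 0 ≤ r := by
    rw [← EReal.coe_nonneg, ← h]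
    exact EReal.coe_ennreal_nonneg x
  rw [← EReal.coe_ennreal_eq_coe_ennreal_iff, h, EReal.coe_ennreal_ofReal, max_eq_left hr]

theorem card_aut_rep (G : C) : Nat.card (Aut (cls G).rep) = Nat.card (Aut G) := by
  obtain ⟨i⟩ := cls_eq_iff.1 (cls_rep (cls G))
  exact Nat.card_congr i.conjAut.toEquiv

theorem eq_top_of_cls_mem_minimalClasses {G : C} (h : cls G ∈ minimalClasses C) (x : QuotObj G) :
    x = ⊤ := by
  obtain ⟨H, hH, hmin⟩ := h
  obtain ⟨e, -⟩ := exists_orderIso_Iic (⊤ : QuotObj H) (H := G) (by rw [quotCls_top, hH])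
  exact e.injective (Subtype.ext ((hmin _).trans (hmin _).symm))

theorem eq_of_le_of_mem_minimalClasses {G : C} {x y : QuotObj G} (hyx : y ≤ x)
    (h : quotCls x ∈ minimalClasses C) : y = x := by
  obtain ⟨e, -⟩ := exists_orderIso_rep x
  have h₁ := eq_top_of_cls_mem_minimalClasses (G := (quotCls x).rep) (by rwa [cls_rep])
    (e.symm ⟨y, hyx⟩)
  rw [← orderIso_top e, ← h₁, e.apply_symm_apply]

variable [DiamondCategory C]

/-- Two quotients of one object that are minimal both equal their meet, so joins create nothing new.
Hence the level generated by the empty set contains only minimal classes. -/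
theorem isFormation_minimalClasses : IsFormation (minimalClasses C) where
  downward G x h := by
    rw [eq_top_of_cls_mem_minimalClasses h x, quotCls_top]
    exact h
  join G x y z hz hx hy := by
    obtain rfl : x ⊔ y = z := isLUB_pair.unique hz
    have h₁ := eq_of_le_of_mem_minimalClasses (inf_le_left : x ⊓ y ≤ x) hx
    have h₂ := eq_of_le_of_mem_minimalClasses (inf_le_right : x ⊓ y ≤ y) hy
    rw [← h₂, h₁, sup_idem]
    exact hx
  minimal := subset_rfl

theorem overMinimal_minimalClasses : overMinimal (minimalClasses C) = Set.univ := by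
  refine Set.eq_univ_of_forall fun X => ?_
  exact generate_subset isFormation_minimalClasses (by simp) (X.mem (levelOf ∅))

theorem one_le_Z {G F : C} (π : Epis G F) : 1 ≤ Z π := by
  have : Nonempty {H : QuotObj G // quotMk π ≤ H ∧ ∀ K₁ K₂ : QuotObj G, quotMk π ≤ K₁ →
      quotMk π ≤ K₂ → H ⊔ (K₁ ⊓ K₂) = (H ⊔ K₁) ⊓ (H ⊔ K₂)} :=
    ⟨⟨⊤, le_top, fun _ _ _ _ => by simp only [top_sup_eq, inf_idem]⟩⟩
  exact Nat.card_pos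

/-- The moments divided by the orders of the automorphism groups. -/
def normalizedMoment (M : IsoClass C → ℝ) (G : IsoClass C) : ℝ≥0∞ :=
  ENNReal.ofReal (M G / Nat.card (Aut G.rep))

theorem card_aut_pos (G : C) : 0 < Nat.card (Aut G) := Nat.card_pos

/-- Choosing one epimorphism for each quotient of class `F` gives a subfamily of the well-behaved
sum, and `Z ≥ 1` allows the factor `Z ^ 3` to be dropped. -/
theorem WellBehavedAt.isMoebiusSummable {W : Set (IsoClass C)} {M : IsoClass C → ℝ}
    (hM : WellBehavedAt W M) : IsMoebiusSummable W (normalizedMoment M) where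
  ne_top G _ := ENNReal.ofReal_ne_top
  tsum_ne_top F hF := by
    classical
    choose s hs using fun (x : Σ G : W, {y : QuotObj G.1.rep // quotCls y = F}) =>
      exists_quotMk_eq (F := F.rep) (x.2.2.trans (cls_rep F).symm)
    let j : (Σ G : W, {y : QuotObj G.1.rep // quotCls y = F}) → Σ G : W, Epis G.1.rep F.rep :=
      fun x => ⟨x.1, s x⟩
    have hj : Function.Injective j := by
      rintro ⟨G, y⟩ ⟨G', y'⟩ h
      obtain rfl : G = G' := congrArg Sigma.fst h
      have h' : s ⟨G, y⟩ = s ⟨G, y'⟩ := eq_of_heq (Sigma.mk.inj h).2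
      have h₁ := hs ⟨G, y⟩
      rw [h', hs] at h₁
      exact congrArg (Sigma.mk G) (Subtype.ext h₁.symm)
    have h₁ := (hM F.rep (by rwa [cls_rep])).comp_injective hj
    have h₂ : Summable fun x : Σ G : W, {y : QuotObj G.1.rep // quotCls y = F} =>
        ((moebius x.2.1 ⊤).natAbs : ℝ) * (M x.1 / Nat.card (Aut x.1.1.rep)) := by
      refine Summable.of_norm_bounded h₁ fun x => ?_
      simp only [Function.comp_apply, mu, hs, j, norm_mul, norm_div, Real.norm_eq_abs, Nat.abs_cast]
      have hZ : (1 : ℝ) ≤ (Z (s x) : ℝ) ^ 3 := one_le_pow₀ (by exact_mod_cast one_le_Z (s x))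
      rw [Nat.cast_natAbs, Int.cast_abs, ← mul_div_assoc, div_mul_eq_mul_div, mul_div_right_comm]
      calc |(moebius x.2.1 ⊤ : ℝ)| / (Nat.card (Aut x.1.1.rep) : ℝ) * |M x.1|
          = |(moebius x.2.1 ⊤ : ℝ)| / (Nat.card (Aut x.1.1.rep) : ℝ) * 1 * |M x.1| := by ring
        _ ≤ |(moebius x.2.1 ⊤ : ℝ)| / (Nat.card (Aut x.1.1.rep) : ℝ) * (Z (s x) : ℝ) ^ 3
            * |M x.1| := by gcongr
        _ = _ := by ring
    have h₃ := h₂.tsum_ofReal_ne_top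
    rw [ENNReal.tsum_sigma'] at h₃
    refine ne_of_eq_of_ne (tsum_congr fun G => ?_) h₃
    simp only [ENNReal.ofReal_mul (Nat.cast_nonneg _), ENNReal.ofReal_natCast]
    rw [tsum_fintype, ← Finset.sum_mul, absMu, finsum_eq_sum_of_fintype]
    push_cast
    rfl

theorem normalizedMoment_eq (M : IsoClass C → ℝ) (G : IsoClass C) :
    normalizedMoment M G = ENNReal.ofReal (M G) / Nat.card (Aut G.rep) := by
  rw [normalizedMoment, ENNReal.ofReal_div_of_pos (by exact_mod_cast card_aut_pos G.rep),
    ENNReal.ofReal_natCast]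

/-- Weights with the given moments on all levels are consistent. -/
theorem isConsistent_of_hasNormalizedMoments {m : IsoClass C → ℝ≥0∞}
    (hm : ∀ K : Level C, IsMoebiusSummable K.1 m) {w : Level C → IsoClass C → ℝ≥0∞}
    (hw : ∀ K, HasNormalizedMoments K.1 (w K) m) : IsConsistent w where
  support K F hF := (hw K).support F hF
  ne_top K F := (hw K).ne_top (hm K) F
  tsum_eq K K' h F := by
    classical
    -- The pushforward of the weights from `K'` to `K` has the same moments on `K`, so uniqueness
    -- identifies it with `w K`.
    have key : HasNormalizedMoments K.1
        (fun F => ∑' F' : maxQuot K.1 ⁻¹' {F}, w K' F') m := by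
      constructor
      · intro H hH
        have : IsEmpty (maxQuot K.1 ⁻¹' {H}) :=
          ⟨fun x => hH (x.2 ▸ K.isFormation.maxQuot_mem x.1)⟩
        exact tsum_empty
      · intro G hG
        rw [← (hw K').tsum_eq G (h hG)]
        calc ∑' H, (∑' F' : maxQuot K.1 ⁻¹' {H}, w K' F') * (quotCount H G : ℝ≥0∞)
            = ∑' H, ∑' F' : maxQuot K.1 ⁻¹' {H}, w K' F' * (quotCount F' G : ℝ≥0∞) := by
              refine tsum_congr fun H => ?_
              rw [← ENNReal.tsum_mul_right]
              refine tsum_congr fun F' => ?_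
              have hF' : maxQuot K.1 F'.1 = H := F'.2
              rw [← quotCount_maxQuot K.isFormation F'.1 hG, hF']
          _ = ∑' F', w K' F' * (quotCount F' G : ℝ≥0∞) :=
              ENNReal.tsum_fiberwise (fun F' => w K' F' * (quotCount F' G : ℝ≥0∞)) (maxQuot K.1)
    exact congrFun (key.unique K.isFormation (hw K) (hm K)) F

variable [Countable (IsoClass C)]

theorem moment_eq (ρ : Measure (ProIso C)) (K : Level C) {G : C} (hG : cls G ∈ K.1) :
    moment ρ G = Nat.card (Aut G) * ∑' H, ρ (basicOpen K H) * quotCount H (cls G) := by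
  have hle : (levelOf {cls G} : Level C).1 ⊆ K.1 := (levelOf_subset_iff _).2 (by simpa using hG)
  have h : ∀ X : ProIso C, (epiCount X G : ℝ≥0∞)
      = Nat.card (Aut G) * quotCount (X.val K) (cls G) := by
    intro X
    rw [epiCount, card_epis_rep, X.val_eq hle,
      quotCount_maxQuot (Level.isFormation _) _ (mem_levelOf (by simp)), Nat.cast_mul]
  simp only [moment, h]
  rw [lintegral_comp_val ρ K fun F => (Nat.card (Aut G) : ℝ≥0∞) * quotCount F (cls G),
    ← ENNReal.tsum_mul_left]
  refine tsum_congr fun H => ?_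
  rw [mul_assoc, mul_comm (quotCount H (cls G) : ℝ≥0∞)]

theorem tsum_quotCount_eq (ρ : Measure (ProIso C)) (K : Level C) {G : IsoClass C} (hG : G ∈ K.1) :
    ∑' H, ρ (basicOpen K H) * quotCount H G = moment ρ G.rep / Nat.card (Aut G.rep) := by
  rw [moment_eq ρ K (by rwa [cls_rep]), cls_rep]
  refine (ENNReal.eq_div_iff ?_ (ENNReal.natCast_ne_top _)).2 rfl
  exact_mod_cast (card_aut_pos G.rep).ne'

theorem HasMoments.hasNormalizedMoments {ρ : Measure (ProIso C)} {M : IsoClass C → ℝ}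
    (h : HasMoments ρ M) (K : Level C) :
    HasNormalizedMoments K.1 (fun H => ρ (basicOpen K H)) (normalizedMoment M) where
  support H hH := by rw [basicOpen_eq_empty hH, measure_empty]
  tsum_eq G hG := by
    rw [tsum_quotCount_eq ρ K hG, ennreal_eq_ofReal (h G.rep), cls_rep, normalizedMoment_eq]

theorem hasMoments_of_hasNormalizedMoments {ρ : Measure (ProIso C)} {M : IsoClass C → ℝ}
    (hM : ∀ G, 0 ≤ M G)
    (h : ∀ K : Level C, HasNormalizedMoments K.1 (fun H => ρ (basicOpen K H)) (normalizedMoment M)) :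
    HasMoments ρ M := by
  intro G
  have hG : cls G ∈ (levelOf {cls G} : Level C).1 := mem_levelOf (by simp)
  have h0 : (Nat.card (Aut G) : ℝ≥0∞) ≠ 0 := by exact_mod_cast (card_aut_pos G).ne'
  rw [moment_eq ρ _ hG, (h _).tsum_eq _ hG, normalizedMoment_eq, card_aut_rep,
    ENNReal.mul_div_cancel h0 (ENNReal.natCast_ne_top _), EReal.coe_ennreal_ofReal,
    max_eq_left (hM _)]

/-- Over a finite `S` the total mass is a finite sum of masses of basic open sets, so it converges
to a finite limit. A basic open set lies either inside `overMinimal S` or outside it. -/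
theorem weaklyConverges_restrict {ρ : ℕ → Measure (ProIso C)} {ρ' : Measure (ProIso C)}
    (h : ∀ K F, Tendsto (fun t => ρ t (basicOpen K F)) atTop (𝓝 (ρ' (basicOpen K F))))
    (hfin : ∀ K F, ρ' (basicOpen K F) ≠ ∞) {S : Set (IsoClass C)} (hS : S.Finite) :
    ρ' (overMinimal S) ≠ ∞ ∧ WeaklyConverges (fun t => (ρ t).restrict (overMinimal S))
      (ρ'.restrict (overMinimal S)) := by
  classical
  have := hS.fintype
  have hcyl : ∀ τ : Measure (ProIso C),
      τ (overMinimal S) = ∑ F : S, τ (basicOpen (levelOf ∅) F) := fun τ => by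
    rw [← tsum_fintype (L := SummationFilter.unconditional S), ← measure_cylinder]
    rfl
  have hne : ρ' (overMinimal S) ≠ ∞ := by
    rw [hcyl]
    exact ENNReal.sum_ne_top.2 fun F _ => hfin _ _
  refine ⟨hne, weaklyConverges_of_tendsto (fun K F => ?_) ?_ ?_⟩
  · simp only [Measure.restrict_apply (measurableSet_basicOpen K F)]
    have hval : ∀ X ∈ basicOpen K F, X.val (levelOf ∅) = maxQuot (levelOf ∅ : Level C).1 F := by
      rintro X rfl
      exact X.val_eq (levelOf_empty_subset K)
    by_cases hF : maxQuot (levelOf ∅ : Level C).1 F ∈ S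
    · have : basicOpen K F ∩ overMinimal S = basicOpen K F :=
        Set.inter_eq_left.2 fun X hX => by
          change X.val _ ∈ S
          rwa [hval X hX]
      rw [this]
      exact h K F
    · have : basicOpen K F ∩ overMinimal S = ∅ :=
        Set.disjoint_iff_inter_eq_empty.1 (Set.disjoint_left.2 fun X hX hX' => hF (by
          rw [← hval X hX]
          exact hX'))
      simp [this]
  · simp only [Measure.restrict_apply_univ, hcyl]
    exact tendsto_finsetSum _ fun F _ => h _ _
  · rwa [Measure.restrict_apply_univ]

end Main

end DiamondMoment

end

open DiamondMoment
theorem theoremT {C : Type u} [Category.{v} C] [DiamondCategory C] [Countable (IsoClass C)]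
    (M : IsoClass C → ℝ) (hM : WellBehaved M)
    (ν : ℕ → Measure (ProIso C))
    (hν : ∀ G : C, Tendsto (fun t => (moment (ν t) G : EReal)) atTop (𝓝 (M (cls G) : EReal))) :
    ∃ ν' : Measure (ProIso C),
      -- `ν'` has moments `M`, is the only such measure, and is given by the explicit formula
      HasMoments ν' M ∧
      (∀ ρ : Measure (ProIso C), HasMoments ρ M → ρ = ν') ∧
      (∀ (L : Level C) (F : IsoClass C), F ∈ L.1 →
        ν' (basicOpen L F) ≠ ∞ ∧
        HasSum (fun G : L.1 =>
            (muHat F G.1.rep : ℝ) / (Nat.card (Aut G.1.rep) : ℝ) * M G.1)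
          (ν' (basicOpen L F)).toReal) ∧
      -- weak convergence over any finite set of minimal objects
      (∀ S : Set (IsoClass C), S.Finite → S ⊆ minimalClasses C →
        WeaklyConverges (fun t => (ν t).restrict (overMinimal S)) (ν'.restrict (overMinimal S))) ∧
      -- weak convergence on the whole space if there are finitely many minimal objects
      ((minimalClasses C).Finite → IsFiniteMeasure ν' ∧ WeaklyConverges ν ν') ∧
      -- weak convergence on the whole space if no mass is lost in the limit
      (ν' Set.univ ≠ ∞ → Tendsto (fun t => ν t Set.univ) atTop (𝓝 (ν' Set.univ)) →
        WeaklyConverges ν ν') := by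
  -- Limits of nonnegative moments are nonnegative, so passing through `ENNReal.ofReal` loses
  -- nothing.
  have hM0 : ∀ G, 0 ≤ M G := by
    intro G
    have h := ge_of_tendsto' (hν G.rep) fun t => EReal.coe_ennreal_nonneg _
    rwa [cls_rep, EReal.coe_nonneg] at h
  have hm : ∀ K : Level C, IsMoebiusSummable K.1 (normalizedMoment M) := fun K => (hM K).isMoebiusSummable
  have hlim : ∀ K : Level C, ∀ G ∈ K.1, Tendsto
      (fun t => ∑' H, ν t (basicOpen K H) * (quotCount H G : ℝ≥0∞)) atTop (𝓝 (normalizedMoment M G)) := by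
    intro K G hG
    simp only [tsum_quotCount_eq _ K hG, normalizedMoment_eq]
    refine ENNReal.Tendsto.div_const ?_ (.inr ?_)
    · rw [← EReal.tendsto_coe_ennreal, EReal.coe_ennreal_ofReal, max_eq_left (hM0 G)]
      simpa using hν G.rep
    · exact_mod_cast (card_aut_pos G.rep).ne'
  choose w hw hwlim using fun K : Level C => exists_hasNormalizedMoments_tendsto K
    (fun t H hH => by rw [basicOpen_eq_empty hH, measure_empty]) (hlim K) (hm K)
  obtain ⟨ν', hν'⟩ := (isConsistent_of_hasNormalizedMoments hm hw).exists_measure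
  have hw' : ∀ K, w K = fun F => ν' (basicOpen K F) := fun K => funext fun F => (hν' K F).symm
  have hnorm : ∀ K : Level C,
      HasNormalizedMoments K.1 (fun F => ν' (basicOpen K F)) (normalizedMoment M) := fun K => hw' K ▸ hw K
  have hfin : ∀ K F, ν' (basicOpen K F) ≠ ∞ := fun K F => (hnorm K).ne_top (hm K) F
  have hconv : ∀ K F, Tendsto (fun t => ν t (basicOpen K F)) atTop (𝓝 (ν' (basicOpen K F))) :=
    fun K F => hν' K F ▸ hwlim K F
  refine ⟨ν', hasMoments_of_hasNormalizedMoments hM0 hnorm, fun ρ hρ => ?_, fun L F hF => ?_,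
    fun S hS _ => (weaklyConverges_restrict hconv hfin hS).2, fun hfinite => ?_,
    fun hne huniv => weaklyConverges_of_tendsto hconv huniv hne⟩
  · refine (measure_ext_of_basicOpen (fun K F => ?_) hfin).symm
    exact congrFun ((hnorm K).unique K.isFormation (hρ.hasNormalizedMoments K) (hm K)) F
  · refine ⟨hfin L F, ?_⟩
    convert (hnorm L).hasSum L.isFormation (hm L) hF using 2 with G
    rw [normalizedMoment, ENNReal.toReal_ofReal (div_nonneg (hM0 _) (Nat.cast_nonneg _))]
    ring
  · have h := weaklyConverges_restrict hconv hfin hfinite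
    simp only [overMinimal_minimalClasses, Measure.restrict_univ] at h
    exact ⟨⟨h.1.lt_top⟩, h.2⟩
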